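/- Let $p>3$ be prime, $0\le m\le p-1$, $\zeta_p=e^{2\pi i/p}$, $s_p=\frac{1}{24}(p^2-1)$, and $q^s=e^{2\pi i s z}$ for $\operatorname{Im} z>0$ and $s\in\mathbb{Q}$. The crank of a partition is its largest part if it has no ones (and $0$ for the empty partition), and otherwise the number of parts larger than the number of ones, minus the number of ones. Let $M(k,p,n)$ be the number of partitions of $n$ with crank congruent to $k$ modulo $p$, except that, as usual, for $n=1$ the crank counts are taken to be $M(0,1)=-1$, $M(1,1)=M(-1,1)=1$ and $M(j,1)=0$ for $|j|\ge 2$, and $M(k,p,1)=\sum_{j\equiv k \,(\mathrm{mod}\, p)}M(j,1)$. Put $$\mathcal{K}^{(C)}_{p,m}(\zeta_p,z)=q^{m/p}\prod_{n=1}^\infty(1-q^{pn})\sum_{n=\lceil (s_p-m)/p\rceil}^\infty\Big(\sum_{k=0}^{p-1}M(k,p,pn+m-s_p)\,\zeta_p^{k}\Big)q^n .$$ For a cusp $a/c\in\mathbb{Q}\cup\{\infty\}$ and a function $f$ of weight $1$ on the upper half-plane, the invariant order $\operatorname{ord}(f;a/c)$ is the order at infinity of $(f|_1A)(z)=(\gamma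 z+\delta)^{-1}f(Az)$, where $A=\begin{pmatrix}\alpha&\beta\\ \gamma&\delta\end{pmatrix}\in \mathrm{SL}_2(\mathbb{Z})$ is any matrix with $A\infty=a/c$. Here the order at infinity of a function with a convergent expansion $\sum_{j\ge 0}a_j q^{(m_0+j)/N}$ ($N\ge1$ and $m_0$ integers, $a_0\neq0$) is $m_0/N$, and the order of the zero function is $\infty$. Then the following invariant orders exist and satisfy: (i) $\operatorname{ord}\big(\mathcal{K}^{(C)}_{p,m}(\zeta_p,z);0\big)=-\dfrac{(p-1)(p-11)}{24p}$ if $p>11$, and it is $\ge 0$ if $p\le 11$. (ii) For every integer $n$ with $2\le n\le\frac{p-1}{2}$, $$\operatorname{ord}\Big(\mathcal{K}^{(C)}_{p,m}(\zeta_p,z);\frac1n\Big)=-\frac{1}{2p}\Big[\frac{(p-1)(p+1)}{12}+n(n-p)\Big]\quad\text{if } n<\frac p2-\frac12\sqrt{\frac{2p^2+1}{3}},$$ and it is $\ge0$ otherwise. (iii) For every integer $n$ with $2\le n\le\frac{p-1}{2}$, $$\operatorname{ord}\Big(\mathcal{K}^{(C)}_{p,m}(\zeta_p,z);\frac np\Big)\ge\frac{p^2-1}{24p}.$$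 -/

import Mathlib

open scoped UpperHalfPlane ModularForm MatrixGroups

noncomputable section

namespace CrankDissection

/-- The (Andrews–Garvan) crank of a partition: the largest part if there are no ones; otherwise
the number of parts larger than the number of ones, minus the number of ones.
(The empty partition has crank `0`.) -/
def crank {n : ℕ} (P : n.Partition) : ℤ :=
  if P.parts.count 1 = 0 then (P.parts.sup : ℤ)
  else ((P.parts.filter fun x => P.parts.count 1 < x).card : ℤ) - (P.parts.count 1 : ℤ)

/-- `M(r, t, n)`: the number of partitions of `n` with crank congruent to `r` modulo `t`,
with the usual convention for `n = 1`, where the crank counts are read off from the coefficient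
`-1 + x + x⁻¹` of `q` in `∏ (1 - qⁿ) / ((1 - x qⁿ)(1 - x⁻¹ qⁿ))`, i.e.
`M(0, 1) = -1`, `M(1, 1) = M(-1, 1) = 1`, and `M(k, 1) = 0` for all other `k`. -/
def crankCount (r : ℤ) (t n : ℕ) : ℤ :=
  if n = 1 then
    (if (1 : ℤ) ≡ r [ZMOD t] then 1 else 0) + (if (-1 : ℤ) ≡ r [ZMOD t] then 1 else 0)
      - (if (0 : ℤ) ≡ r [ZMOD t] then 1 else 0)
  else (Nat.card {P : n.Partition // crank P ≡ r [ZMOD t]} : ℤ)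

/-- `ζ_p = exp(2πi / p)`. -/
def zeta (p : ℕ) : ℂ := Complex.exp (2 * Real.pi * Complex.I / p)

/-- `q^s = exp(2πi s z)` for a rational exponent `s`. -/
def qpow (s : ℚ) (z : ℍ) : ℂ := Complex.exp (2 * Real.pi * Complex.I * (s : ℂ) * (z : ℂ))

/-- `s_p = (p² - 1) / 24` (an integer for every prime `p > 3`). -/
def sp (p : ℕ) : ℕ := (p ^ 2 - 1) / 24

/-- The element of the `p`-dissection of the crank generating function
`K_{p,m}(ζ_p^ℓ, z) = q^{m/p} ∏_{n ≥ 1} (1 - q^{pn})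
  ∑_{n ≥ ⌈(s_p - m)/p⌉} (∑_{k=0}^{p-1} M(k, p, pn + m - s_p) ζ_p^{kℓ}) qⁿ`.
For `0 ≤ m ≤ p - 1` the range of summation consists of the natural numbers `n` with
`s_p ≤ pn + m`. -/
def K (p m l : ℕ) (z : ℍ) : ℂ :=
  qpow ((m : ℚ) / p) z * (∏' n : ℕ, (1 - qpow (p * (n + 1)) z)) *
    ∑' n : ℕ, if sp p ≤ p * n + m then
      (∑ k ∈ Finset.range p, (crankCount k p (p * n + m - sp p) : ℂ) * zeta p ^ (k * l)) * qpow n z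
    else 0

/-- `HasOrderAtInfty g r`: the function `g` on the upper half-plane has an expansion
`g(z) = ∑_{j ≥ 0} a_j q^{(m₀ + j)/N}` (for some `N ≥ 1`, `m₀ ∈ ℤ`) converging on the whole upper
half-plane, with `a₀ ≠ 0`, and `r = m₀/N`; the zero function has order `⊤ = ∞`. -/
def HasOrderAtInfty (g : ℍ → ℂ) (r : WithTop ℚ) : Prop :=
  (g = 0 ∧ r = ⊤) ∨
    ∃ (N : ℕ) (m₀ : ℤ) (a : ℕ → ℂ), 0 < N ∧ a 0 ≠ 0 ∧ r = (((m₀ : ℚ) / N : ℚ) : WithTop ℚ) ∧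
      ∀ z : ℍ, HasSum (fun j : ℕ => a j * qpow (((m₀ : ℚ) + j) / N) z) (g z)

/-- `HasInvariantOrder k f c r`: the invariant order of `f`, of weight `k`, at the cusp
`c ∈ ℚ ∪ {∞}` is `r`, i.e. `f ∣[k] A` has order `r` at infinity whenever `A ∈ SL₂(ℤ)` and
`A ∞ = c`. -/
def HasInvariantOrder (k : ℤ) (f : ℍ → ℂ) (c : OnePoint ℚ) (r : WithTop ℚ) : Prop :=
  ∀ A : SL(2, ℤ), Matrix.SpecialLinearGroup.mapGL ℚ A • (OnePoint.infty : OnePoint ℚ) = c →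
    HasOrderAtInfty (f ∣[k] A) r

end CrankDissection

end

/-! All three claims are read off one formula. At a p-th root of unity x the crank generating
function is (q)_∞ / ((xq)_∞ (x⁻¹q)_∞) (`crankSeries_mul`, `hasSum_crankCoeff`). For x = ζ_p this is,
up to a constant and a power of q, 1/(η·𝔨), where 𝔨 is the Klein form of index (0, 1/p). A
root-of-unity filter over y_k = (z + k)/p isolates the required exponents and gives K = ∑_{k<p} c_k
η(pz) / (η(y_k) 𝔨(y_k)) with every c_k ≠ 0 (`K_eq_sum_crankTerm`).

Let A ∈ SL₂(ℤ) have first column (α, c). Each of z ↦ pz and z ↦ (z + k)/p, precomposed with A,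
equals some A' ∈ SL₂(ℤ) after an upper triangular map z ↦ (az + b)/d with ad = p
(`exists_affineMap_smul`). There η contributes order 1/24, and a Klein form with first index ≡ s/p
mod 1, 0 ≤ s < p, contributes (s/p)(s/p - 1)/2, each scaled by a/d. Neither function vanishes on the
half-plane, so every term has an exact order, of one of three kinds. If p ∣ c, every term has order
(p² - 1)/(24p), hence (iii). If p ∤ c and p ∤ α + kc, the k-th term has order 0. If p ∤ c, exactly
one k satisfies p ∣ α + kc, and its term has order `exceptionalOrder p s` with s ≡ c mod p. A
negative exceptional order cannot be cancelled by the other terms and is therefore the order of the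
sum; if it is nonnegative, so is the order of the sum. At the cusps 0 and 1/n one has c = ±1 and c =
±n, and the exceptional order is symmetric under s ↦ p - s, hence (i) and (ii).

The modular input stays elementary. The inversion formula for the theta product follows from
Liouville's theorem (`eq_of_quasiPeriodic`), and the multiplier system of η is never computed: the
relevant quotient has constant 24th power, so it is constant (`exists_eta_ratio`). -/

noncomputable section

namespace CrankDissection

/-! ### Formal Euler products and partition generating functions -/

section FormalProducts

open PowerSeries Finset
open scoped PowerSeries.WithPiTopology

lemma multipliable_one_sub_C_mul_X_pow (b : ℕ → ℂ) :
    Multipliable fun n : ℕ => (1 : ℂ⟦X⟧) - C (b n) * X ^ (n + 1) := by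
  simp_rw [sub_eq_add_neg]
  apply WithPiTopology.multipliable_one_add_of_tendsto_order_atTop_nhds_top
  refine ENat.tendsto_nhds_top_iff_natCast_lt.mpr fun n => Filter.eventually_atTop.mpr ⟨n, ?_⟩
  intro m hm
  rw [order_neg]
  refine lt_of_lt_of_le ?_ (le_order_mul _ _)
  refine lt_add_of_nonneg_of_lt (by simp) ?_
  rw [order_X_pow]
  norm_cast
  lia

/-- The formal product `∏ (1 - b_n X^{n+1})`. -/
def eulerSeries (b : ℕ → ℂ) : ℂ⟦X⟧ := ∏' n : ℕ, (1 - C (b n) * X ^ (n + 1))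

lemma hasProd_eulerSeries (b : ℕ → ℂ) :
    HasProd (fun n : ℕ => (1 : ℂ⟦X⟧) - C (b n) * X ^ (n + 1)) (eulerSeries b) :=
  (multipliable_one_sub_C_mul_X_pow b).hasProd

/-- The partial product `∏_{i < j} (1 - b_i X^{i+1})`. -/
def eulerPartial (b : ℕ → ℂ) (j : ℕ) : ℂ⟦X⟧ := ∏ i ∈ range j, (1 - C (b i) * X ^ (i + 1))

lemma eulerPartial_succ (b : ℕ → ℂ) (j : ℕ) :
    eulerPartial b (j + 1) = eulerPartial b j * (1 - C (b j) * X ^ (j + 1)) :=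
  prod_range_succ _ _

lemma constantCoeff_eulerPartial (b : ℕ → ℂ) (j : ℕ) :
    constantCoeff (eulerPartial b j) = 1 := by
  simp [eulerPartial, map_prod]

lemma eulerPartial_ne_zero (b : ℕ → ℂ) (j : ℕ) : eulerPartial b j ≠ 0 := by
  intro h
  simpa [h] using constantCoeff_eulerPartial b j

lemma tendsto_eulerPartial (b : ℕ → ℂ) :
    Filter.Tendsto (eulerPartial b) Filter.atTop (nhds (eulerSeries b)) :=
  (hasProd_eulerSeries b).tendsto_prod_nat

lemma constantCoeff_eulerSeries (b : ℕ → ℂ) : constantCoeff (eulerSeries b) = 1 := by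
  have h := ((WithPiTopology.continuous_constantCoeff ℂ).tendsto _).comp (tendsto_eulerPartial b)
  refine tendsto_nhds_unique h ?_
  simp [Function.comp_def, constantCoeff_eulerPartial]

lemma eulerSeries_ne_zero (b : ℕ → ℂ) : eulerSeries b ≠ 0 := by
  intro h
  simpa [h] using constantCoeff_eulerSeries b

lemma eulerSeries_zero : eulerSeries 0 = 1 := by simp [eulerSeries]

lemma eulerSeries_split (b : ℕ → ℂ) (j : ℕ) :
    eulerSeries b = eulerPartial b j * eulerSeries (fun i => if i < j then 0 else b i) := by
  refine HasProd.unique (hasProd_eulerSeries b) ?_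
  have h1 : HasProd (fun i => if i < j then (1 : ℂ⟦X⟧) - C (b i) * X ^ (i + 1) else 1)
      (eulerPartial b j) := by
    have : eulerPartial b j =
        ∏ i ∈ range j, (if i < j then (1 : ℂ⟦X⟧) - C (b i) * X ^ (i + 1) else 1) :=
      prod_congr rfl fun i hi => by simp [mem_range.mp hi]
    rw [this]
    exact hasProd_prod_of_ne_finset_one fun i hi => by simp [mem_range.not.mp hi]
  convert! h1.mul (hasProd_eulerSeries (fun i => if i < j then 0 else b i)) using 2 with i
  split_ifs <;> simp

/-- The generating function factors over part sizes. For sizes at least 2 the weights are geometric,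
so the factor is 1/(1 - b X^i) and cancels. Since `b 0 = 0`, the factor of the part 1 survives, and
its weights may be arbitrary. -/
lemma genFun_mul_eulerSeries (f : ℕ → ℕ → ℂ) (b : ℕ → ℂ) (hb : b 0 = 0)
    (hf : ∀ i j, f (i + 2) (j + 1) = b (i + 1) ^ (j + 1)) :
    Nat.Partition.genFun f * eulerSeries b = 1 + ∑' j : ℕ, f 1 (j + 1) • (X : ℂ⟦X⟧) ^ (j + 1) := by
  have h := (Nat.Partition.hasProd_genFun f).mul (hasProd_eulerSeries b)
  have h2 := hasProd_single (f := fun i => ((1 : ℂ⟦X⟧) +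
      ∑' j : ℕ, f (i + 1) (j + 1) • (X : ℂ⟦X⟧) ^ ((i + 1) * (j + 1))) *
      (1 - C (b i) * X ^ (i + 1))) 0 ?_
  · rw [h.unique h2]
    simp [hb]
  · intro i hi
    obtain ⟨i, rfl⟩ := Nat.exists_eq_succ_of_ne_zero hi
    have hc : constantCoeff (C (b (i + 1)) * (X : ℂ⟦X⟧) ^ (i + 2)) = 0 := by simp
    have he : ∑' j : ℕ, f (i + 2) (j + 1) • (X : ℂ⟦X⟧) ^ ((i + 2) * (j + 1)) =
        ∑' j : ℕ, (C (b (i + 1)) * X ^ (i + 2)) ^ (j + 1) := by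
      refine tsum_congr fun j => ?_
      rw [hf, mul_pow, ← map_pow, ← pow_mul, smul_eq_C_mul]
    have h3 := WithPiTopology.tsum_pow_mul_one_sub_of_constantCoeff_eq_zero hc
    rw [(WithPiTopology.summable_pow_of_constantCoeff_eq_zero hc).tsum_eq_zero_add, pow_zero] at h3
    simp only [Nat.succ_eq_add_one, add_assoc, Nat.reduceAdd]
    rw [he, h3]

end FormalProducts

/-! ### The q-binomial theorem -/

section QBinomial

open PowerSeries Finset
open scoped PowerSeries.WithPiTopology

/-- The quotient `(αq; q)_j / (q; q)_j`. -/
def qRatio (α : ℂ) (j : ℕ) : ℂ⟦X⟧ := eulerPartial (fun _ => α) j * (eulerPartial 1 j)⁻¹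

lemma eulerPartial_mul_inv (b : ℕ → ℂ) (j : ℕ) : eulerPartial b j * (eulerPartial b j)⁻¹ = 1 :=
  PowerSeries.mul_inv_cancel _ (by simp [constantCoeff_eulerPartial])

lemma qRatio_mul (α : ℂ) (j : ℕ) : qRatio α j * eulerPartial 1 j = eulerPartial (fun _ => α) j := by
  rw [qRatio, mul_assoc, mul_comm _ (eulerPartial 1 j), eulerPartial_mul_inv, mul_one]

lemma qRatio_zero (α : ℂ) : qRatio α 0 = 1 := by simp [qRatio, eulerPartial]

lemma qRatio_succ (α : ℂ) (j : ℕ) :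
    qRatio α (j + 1) * (1 - X ^ (j + 1)) = qRatio α j * (1 - C α * X ^ (j + 1)) := by
  refine mul_right_cancel₀ (eulerPartial_ne_zero 1 j) ?_
  calc _ = qRatio α (j + 1) * eulerPartial 1 (j + 1) := by
        rw [eulerPartial_succ]; simp only [Pi.one_apply, map_one]; ring
    _ = _ := by
        rw [qRatio_mul, eulerPartial_succ, mul_right_comm, qRatio_mul]

lemma summable_mul_X_pow (u : ℕ → ℂ⟦X⟧) (e : ℕ → ℕ) (he : ∀ j, j ≤ e j) :
    Summable fun j => u j * X ^ e j := by
  apply WithPiTopology.summable_of_tendsto_order_atTop_nhds_top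
  refine ENat.tendsto_nhds_top_iff_natCast_lt.mpr fun n => Filter.eventually_atTop.mpr ⟨n + 1, ?_⟩
  intro m hm
  refine lt_of_lt_of_le ?_ (le_order_mul _ _)
  refine lt_add_of_nonneg_of_lt (by simp) ?_
  rw [order_X_pow]
  have := he m
  norm_cast
  lia

/-- The series `∑ (αq; q)_j / (q; q)_j (τ q^{n+1})^j`. -/
def qBinomialSeries (α τ : ℂ) (n : ℕ) : ℂ⟦X⟧ :=
  ∑' j : ℕ, qRatio α j * C τ ^ j * X ^ ((n + 1) * j)

lemma hasSum_qBinomialSeries (α τ : ℂ) (n : ℕ) :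
    HasSum (fun j : ℕ => qRatio α j * C τ ^ j * X ^ ((n + 1) * j)) (qBinomialSeries α τ n) :=
  (summable_mul_X_pow _ _ fun j => by nlinarith).hasSum

/-- With t = τq^{n+1} this is f(t) - f(tq) = t (f(t) - αq f(tq)), checked termwise from the
recursion `qRatio_succ`. -/
lemma qBinomialSeries_step (α τ : ℂ) (n : ℕ) :
    qBinomialSeries α τ n * (1 - C τ * X ^ (n + 1)) =
      (1 - C (α * τ) * X ^ (n + 2)) * qBinomialSeries α τ (n + 1) := by
  have h0 := hasSum_qBinomialSeries α τ n
  have h1 := hasSum_qBinomialSeries α τ (n + 1)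
  have h2 := (hasSum_nat_add_iff' 1).mpr (h0.sub h1)
  have h3 := (h0.sub (h1.mul_left (C α * X))).mul_left (C τ * X ^ (n + 1))
  have h4 := h2.unique (h3.congr_fun ?_)
  · simp only [sum_range_one, mul_zero, pow_zero, mul_one, sub_self, sub_zero] at h4
    rw [map_mul]
    linear_combination h4
  · intro j
    have := qRatio_succ α j
    simp only [pow_succ, mul_add, add_mul, pow_add, mul_one, one_mul] at this ⊢
    linear_combination (C τ ^ j * C τ * X ^ (n * j) * X ^ n * X ^ j * X) * this

lemma tendsto_qBinomialSeries (α τ : ℂ) :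
    Filter.Tendsto (qBinomialSeries α τ) Filter.atTop (nhds 1) := by
  rw [WithPiTopology.tendsto_iff_coeff_tendsto]
  intro d
  refine tendsto_const_nhds.congr' ?_
  filter_upwards [Filter.eventually_ge_atTop d] with n hn
  have h0 := (hasSum_nat_add_iff' 1).mpr (hasSum_qBinomialSeries α τ n)
  have h1 := ((summable_mul_X_pow (fun j => qRatio α (j + 1) * C τ ^ (j + 1))
    (fun j => (n + 1) * j) fun j => by nlinarith).hasSum).mul_right (X ^ (n + 1))
  have h2 := h0.unique (h1.congr_fun fun j => by ring)
  simp only [sum_range_one, mul_zero, pow_zero, mul_one, qRatio_zero] at h2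
  rw [eq_add_of_sub_eq h2, map_add, coeff_mul_X_pow', if_neg (by lia), zero_add]

/-- Iterating the functional equation n times leaves two partial products and a series that tends to
1 coefficientwise. -/
theorem qBinomialSeries_mul_eulerSeries (α τ : ℂ) :
    qBinomialSeries α τ 0 * eulerSeries (fun _ => τ) =
      eulerSeries (fun i => if i < 1 then 0 else α * τ) := by
  have hp : ∀ n, qBinomialSeries α τ 0 * eulerPartial (fun _ => τ) n =
      eulerPartial (fun i => if i < 1 then 0 else α * τ) (n + 1) * qBinomialSeries α τ n := by
    intro n
    induction n with
    | zero => simp [eulerPartial]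
    | succ n ih =>
      rw [eulerPartial_succ, ← mul_assoc, ih, mul_assoc, qBinomialSeries_step,
        eulerPartial_succ _ (n + 1)]
      simp [mul_assoc]
  have h1 := (tendsto_eulerPartial (fun _ => τ)).const_mul (qBinomialSeries α τ 0)
  have h2 := ((Filter.tendsto_add_atTop_iff_nat 1).mpr
    (tendsto_eulerPartial (fun i => if i < 1 then 0 else α * τ))).mul (tendsto_qBinomialSeries α τ)
  simp_rw [hp] at h1
  simpa using tendsto_nhds_unique h1 h2

end QBinomial

/-! ### The crank generating function as an infinite product -/

section CrankGeneratingFunction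

open PowerSeries Finset
open scoped PowerSeries.WithPiTopology

lemma toFinsupp_prod {n : ℕ} (P : n.Partition) (f : ℕ → ℕ → ℂ) :
    P.parts.toFinsupp.prod f = ∏ i ∈ P.parts.toFinset, f i (P.parts.count i) := by
  simp [Finsupp.prod]

lemma prod_map_ite_eq_pow (x : ℂ) (j : ℕ) (s : Multiset ℕ) :
    (s.map fun i => if j < i then x else 1).prod = x ^ (s.filter fun i => j < i).card := by
  induction s using Multiset.induction_on with
  | empty => simp
  | cons a s ih =>
    by_cases h : j < a
    · simp [h, ih, pow_succ']
    · simp [h, ih]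

/-- Generating function of the partitions into parts between `2` and `L`. -/
def boundedSeries (L : ℕ) : ℂ⟦X⟧ :=
  Nat.Partition.genFun fun i _ => if 2 ≤ i ∧ i ≤ L then 1 else 0

lemma coeff_boundedSeries (L n : ℕ) : coeff n (boundedSeries L) =
    ∑ P : n.Partition, if P.parts.count 1 = 0 ∧ P.parts.sup ≤ L then 1 else 0 := by
  rw [boundedSeries, Nat.Partition.coeff_genFun]
  refine sum_congr rfl fun P _ => ?_
  rw [toFinsupp_prod, prod_boole]
  congr 1
  simp only [Multiset.mem_toFinset, Multiset.count_eq_zero, Multiset.sup_le, eq_iff_iff]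
  refine ⟨fun h => ⟨fun h1 => by have := h 1 h1; lia, fun i hi => (h i hi).2⟩,
    fun h i hi => ⟨?_, h.2 i hi⟩⟩
  have h0 := P.parts_pos hi
  have h1 : i ≠ 1 := fun e => h.1 (e ▸ hi)
  lia

/-- The polynomial `∏_{2 ≤ i ≤ L} (1 - X^i)`. -/
def partialFromTwo (L : ℕ) : ℂ⟦X⟧ := eulerPartial (fun i => if i = 0 then 0 else 1) L

lemma one_sub_X_mul_partialFromTwo (L : ℕ) :
    (1 - X) * partialFromTwo (L + 1) = eulerPartial 1 (L + 1) := by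
  induction L with
  | zero => simp [partialFromTwo, eulerPartial]
  | succ L ih =>
    rw [eulerPartial_succ _ (L + 1), ← ih, partialFromTwo, eulerPartial_succ _ (L + 1)]
    simp [partialFromTwo, mul_assoc]

lemma boundedSeries_mul (L : ℕ) : boundedSeries L * partialFromTwo L = 1 := by
  have h := genFun_mul_eulerSeries (fun i _ => if 2 ≤ i ∧ i ≤ L then (1 : ℂ) else 0)
    (fun i => if i < L then (if i = 0 then 0 else 1) else 0) (by simp) (by
      intro i j
      by_cases h : i + 1 < L
      · simp [h, show i + 2 ≤ L by lia]
      · simp [h, show ¬ i + 2 ≤ L by lia])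
  rw [eulerSeries_split _ L] at h
  have h2 : (fun i => if i < L then (0 : ℂ) else if i < L then (if i = 0 then 0 else 1) else 0)
      = 0 := by
    ext i; split_ifs <;> rfl
  have h3 : eulerPartial (fun i => if i < L then (if i = 0 then 0 else 1) else 0) L =
      partialFromTwo L := prod_congr rfl fun i hi => by simp [mem_range.mp hi]
  rw [h2, h3, eulerSeries_zero] at h
  simpa [boundedSeries] using h

/-- The difference counts partitions without ones whose largest part is exactly L + 2, namely
q^{L+2} / ∏_{2 ≤ i ≤ L+2} (1 - q^i). The factor 1 - X completes the denominator to (q; q)_{L+2}. -/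
lemma boundedSeries_sub (L : ℕ) :
    boundedSeries (L + 2) - boundedSeries (L + 1) = (1 - X) * qRatio 0 (L + 2) * X ^ (L + 2) := by
  refine mul_right_cancel₀ (eulerPartial_ne_zero 1 (L + 2)) ?_
  have e1 := boundedSeries_mul (L + 2)
  have e2 := boundedSeries_mul (L + 1)
  have e3 : partialFromTwo (L + 2) = partialFromTwo (L + 1) * (1 - X ^ (L + 2)) := by
    simp [partialFromTwo, eulerPartial_succ _ (L + 1)]
  have e4 := one_sub_X_mul_partialFromTwo (L + 1)
  have e5 := qRatio_mul 0 (L + 2)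
  have e6 : eulerPartial (fun _ => 0) (L + 2) = 1 := by simp [eulerPartial]
  rw [e6] at e5
  calc _ = (1 - X) * (boundedSeries (L + 2) * partialFromTwo (L + 2) -
        boundedSeries (L + 1) * partialFromTwo (L + 2)) := by rw [← e4]; ring
    _ = (1 - X) * (1 - (boundedSeries (L + 1) * partialFromTwo (L + 1)) * (1 - X ^ (L + 2))) := by
        rw [e1, e3]; ring
    _ = (1 - X) * (qRatio 0 (L + 2) * eulerPartial 1 (L + 2)) * X ^ (L + 2) := by
        rw [e2, e5]; ring
    _ = _ := by ring

/-- The weight function selecting, among partitions having a one, those with `j` ones. -/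
def onesWeight (x : ℂ) (j a : ℕ) (i c : ℕ) : ℂ :=
  if i = 1 then (if c = a then 1 else 0) else if j < i then x ^ c else 1

/-- Generating function of the partitions with exactly `j` ones, where each part larger than `j`
is weighted by `x`. -/
def onesSeries (x : ℂ) (j : ℕ) : ℂ⟦X⟧ :=
  Nat.Partition.genFun (onesWeight x j j) - Nat.Partition.genFun (onesWeight x j 0)

/-- A part that does not occur contributes the factor 1, so the first generating function in
`onesSeries` also counts partitions without ones. The second one counts only those, with the same
weights, and removes them. -/
lemma coeff_onesSeries (x : ℂ) (j n : ℕ) : coeff n (onesSeries x (j + 1)) =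
    ∑ P : n.Partition, if P.parts.count 1 = j + 1 then
      x ^ (P.parts.filter fun i => j + 1 < i).card else 0 := by
  rw [onesSeries, map_sub, Nat.Partition.coeff_genFun, Nat.Partition.coeff_genFun,
    ← sum_sub_distrib]
  refine sum_congr rfl fun P _ => ?_
  rw [toFinsupp_prod, toFinsupp_prod]
  by_cases h1 : 1 ∈ P.parts
  · have hm : 1 ∈ P.parts.toFinset := Multiset.mem_toFinset.mpr h1
    have hc : P.parts.count 1 ≠ 0 := fun h => Multiset.count_eq_zero.mp h h1
    rw [prod_eq_zero (f := fun i => onesWeight x (j + 1) 0 i _) hm (by simp [onesWeight, hc]),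
      sub_zero]
    split_ifs with hj
    · have : ∀ i ∈ P.parts.toFinset, onesWeight x (j + 1) (j + 1) i (P.parts.count i) =
          (if j + 1 < i then x else 1) ^ P.parts.count i := by
        intro i _
        by_cases h : i = 1
        · subst h; simp [onesWeight, hj]
        · simp only [onesWeight, if_neg h]; split_ifs <;> simp
      rw [prod_congr rfl this, ← prod_multiset_map_count]
      exact prod_map_ite_eq_pow x (j + 1) P.parts
    · exact prod_eq_zero hm (by simp [onesWeight, hj])
  · have hc : P.parts.count 1 = 0 := Multiset.count_eq_zero.mpr h1
    rw [if_neg (by lia), sub_eq_zero]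
    refine prod_congr rfl fun i hi => ?_
    have : i ≠ 1 := fun h => h1 (h ▸ Multiset.mem_toFinset.mp hi)
    simp [onesWeight, this]

/-- Parts from 2 to j + 1 have weight 1 and larger parts have weight x; completing both products to
start at 1 yields the ratio (xq)_{j+1} / (q)_{j+1}. -/
lemma onesSeries_mul (x : ℂ) (j : ℕ) :
    onesSeries x (j + 1) * eulerSeries (fun _ => x) =
      (1 - X) * qRatio x (j + 1) * X ^ (j + 1) := by
  set b : ℕ → ℂ := fun i => if i < j + 1 then (if i = 0 then 0 else 1) else x with hb
  have hf : ∀ a i k, onesWeight x (j + 1) a (i + 2) (k + 1) = b (i + 1) ^ (k + 1) := by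
    intro a i k
    simp only [onesWeight, hb]
    by_cases h : j + 1 < i + 2
    · simp [h, show ¬ i < j by lia]
    · simp [h, show i < j by lia]
  have h1 := genFun_mul_eulerSeries _ b (by simp [hb]) (hf (j + 1))
  have h2 := genFun_mul_eulerSeries _ b (by simp [hb]) (hf 0)
  have t1 : ∑' k : ℕ, onesWeight x (j + 1) (j + 1) 1 (k + 1) • (X : ℂ⟦X⟧) ^ (k + 1) =
      X ^ (j + 1) := by
    rw [tsum_eq_single j (fun k hk => by simp [onesWeight, hk])]
    simp [onesWeight]
  have t2 : ∑' k : ℕ, onesWeight x (j + 1) 0 1 (k + 1) • (X : ℂ⟦X⟧) ^ (k + 1) = 0 := by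
    simp [onesWeight]
  have h3 : onesSeries x (j + 1) * eulerSeries b = X ^ (j + 1) := by
    rw [onesSeries, sub_mul, h1, h2, t1, t2]; ring
  rw [eulerSeries_split b (j + 1)] at h3
  rw [eulerSeries_split _ (j + 1)]
  have h4 : (fun i => if i < j + 1 then 0 else b i) = fun i => if i < j + 1 then 0 else x := by
    ext i; simp only [hb]; split_ifs <;> rfl
  have h5 : eulerPartial b (j + 1) = partialFromTwo (j + 1) :=
    prod_congr rfl fun i hi => by simp only [hb, if_pos (mem_range.mp hi)]
  rw [h4, h5] at h3
  refine mul_right_cancel₀ (eulerPartial_ne_zero 1 (j + 1)) ?_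
  calc _ = (1 - X) * eulerPartial (fun _ => x) (j + 1) * (onesSeries x (j + 1) *
        (partialFromTwo (j + 1) * eulerSeries (fun i => if i < j + 1 then 0 else x))) := by
        rw [← one_sub_X_mul_partialFromTwo]; ring
    _ = (1 - X) * (qRatio x (j + 1) * eulerPartial 1 (j + 1)) * X ^ (j + 1) := by
        rw [h3, qRatio_mul]
    _ = _ := by ring

/-- The crank generating function `∑_P x^{crank P} q^{|P|}`. -/
def crankSeries (x : ℂ) : ℂ⟦X⟧ := PowerSeries.mk fun n => ∑ P : n.Partition, x ^ crank P

lemma sup_ne_one {n : ℕ} (P : n.Partition) (h : P.parts.count 1 = 0) : P.parts.sup ≠ 1 := by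
  intro hs
  have h1 : ∀ i ∈ P.parts, i ≤ 1 := fun i hi => hs ▸ Multiset.le_sup hi
  have h2 : P.parts = 0 := by
    refine Multiset.eq_zero_of_forall_notMem fun i hi => ?_
    have := h1 i hi
    have := P.parts_pos hi
    have : i = 1 := by lia
    exact Multiset.count_eq_zero.mp h (this ▸ hi)
  simp [h2] at hs

lemma hasSum_sup (x : ℂ) {n : ℕ} (P : n.Partition) :
    HasSum (fun L : ℕ => if P.parts.count 1 = 0 ∧ P.parts.sup = L + 2 then x ^ (L + 2) else 0)
      (if P.parts.count 1 = 0 ∧ P.parts.sup ≠ 0 then x ^ crank P else 0) := by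
  by_cases h : P.parts.count 1 = 0 ∧ P.parts.sup ≠ 0
  · have h1 := sup_ne_one P h.1
    obtain ⟨L, hL⟩ : ∃ L, P.parts.sup = L + 2 := ⟨P.parts.sup - 2, by lia⟩
    have : x ^ crank P = if P.parts.count 1 = 0 ∧ P.parts.sup = L + 2 then x ^ (L + 2) else 0 := by
      rw [if_pos ⟨h.1, hL⟩, crank, if_pos h.1, hL, zpow_natCast]
    rw [if_pos h, this]
    exact hasSum_single L fun L' hL' => if_neg fun h => hL' (by lia)
  · rw [if_neg h]
    convert hasSum_zero using 2 with L
    exact if_neg fun h' => h ⟨h'.1, by lia⟩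

lemma hasSum_ones {x : ℂ} (hx : x ≠ 0) {n : ℕ} (P : n.Partition) :
    HasSum (fun j : ℕ => if P.parts.count 1 = j + 1 then
      (x⁻¹) ^ (j + 1) * x ^ (P.parts.filter fun i => j + 1 < i).card else 0)
      (if P.parts.count 1 = 0 then 0 else x ^ crank P) := by
  by_cases h : P.parts.count 1 = 0
  · rw [if_pos h]
    convert hasSum_zero using 2 with j
    exact if_neg (by lia)
  · obtain ⟨j, hj⟩ := Nat.exists_eq_succ_of_ne_zero h
    have : x ^ crank P = if P.parts.count 1 = j + 1 then
      (x⁻¹) ^ (j + 1) * x ^ (P.parts.filter fun i => j + 1 < i).card else 0 := by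
      rw [if_pos hj, crank, if_neg h, hj, zpow_sub₀ hx, zpow_natCast, zpow_natCast, inv_pow,
        div_eq_mul_inv, mul_comm]
    rw [if_neg h, this]
    exact hasSum_single j fun j' hj' => if_neg fun h => hj' (by lia)

lemma sup_eq_zero_iff {n : ℕ} (P : n.Partition) : P.parts.sup = 0 ↔ n = 0 := by
  constructor
  · intro h
    have h2 : P.parts = 0 := Multiset.eq_zero_of_forall_notMem fun i hi => by
      have := P.parts_pos hi
      have : i ≤ P.parts.sup := Multiset.le_sup hi
      lia
    rw [← P.parts_sum, h2, Multiset.sum_zero]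
  · rintro rfl
    simp

/-- Partitions without ones are sorted by largest part, which is then at least 2, and the others by
the number of ones. The empty partition fits neither family and is the subtracted 1. -/
lemma crankSeries_eq {x : ℂ} (hx : x ≠ 0) :
    HasSum (fun L : ℕ => C x ^ (L + 2) * (boundedSeries (L + 2) - boundedSeries (L + 1)) +
      C x⁻¹ ^ (L + 1) * onesSeries x (L + 1)) (crankSeries x - 1) := by
  rw [WithPiTopology.hasSum_iff_hasSum_coeff]
  intro n
  have h1 := (hasSum_sum (s := univ) fun (P : n.Partition) _ => hasSum_sup x P)
  have h2 := (hasSum_sum (s := univ) fun (P : n.Partition) _ => hasSum_ones hx P)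
  convert! h1.add h2 using 1
  · ext L
    rw [map_add, ← map_pow, ← map_pow, coeff_C_mul, coeff_C_mul, coeff_onesSeries, map_sub,
      coeff_boundedSeries, coeff_boundedSeries, ← sum_sub_distrib, mul_sum, mul_sum]
    congr 1
    · refine sum_congr rfl fun P _ => ?_
      by_cases h : P.parts.count 1 = 0
      · simp only [h, true_and]
        rcases lt_trichotomy P.parts.sup (L + 2) with h' | h' | h'
        · rw [if_pos h'.le, if_pos (by lia), if_neg h'.ne]; simp
        · rw [if_pos h'.le, if_neg (by lia), if_pos h']; simp
        · rw [if_neg (by lia), if_neg (by lia), if_neg h'.ne']; simp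
      · simp [h]
    · refine sum_congr rfl fun P _ => ?_
      split_ifs <;> simp
  · rw [map_sub, crankSeries, coeff_mk, coeff_one, ← sum_add_distrib, sub_eq_iff_eq_add]
    by_cases hn : n = 0
    · subst hn
      simp [crank]
    · rw [if_neg hn, add_zero]
      refine sum_congr rfl fun P _ => ?_
      by_cases h : P.parts.count 1 = 0
      · simp [h, sup_eq_zero_iff, hn]
      · simp [h]

/-- The Andrews–Garvan product formula for the crank generating function. -/
theorem crankSeries_mul {x : ℂ} (hx : x ≠ 0) :
    (crankSeries x + C (x - 1) * X) * eulerSeries (fun _ => x) * eulerSeries (fun _ => x⁻¹) =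
      eulerSeries 1 := by
  -- Largest parts start at 2 and numbers of ones at 1, so the q-binomial sums lack their first two
  -- terms and their first term. These missing terms produce the correction (x - 1)X.
  have h1 := (hasSum_nat_add_iff' 2).mpr ((hasSum_qBinomialSeries 0 x 0).mul_left (1 - X))
  have h2 := (hasSum_nat_add_iff' 1).mpr ((hasSum_qBinomialSeries x x⁻¹ 0).mul_left (1 - X))
  have h3 := (h1.mul_right (eulerSeries (fun _ => x))).add h2
  have h4 := ((crankSeries_eq hx).mul_right (eulerSeries (fun _ => x))).unique
    (h3.congr_fun fun L => ?_)
  · simp only [sum_range_succ, sum_range_zero, zero_add, pow_zero,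
      mul_one, qRatio_zero, pow_one, one_mul] at h4
    have h5 := qRatio_succ 0 0
    simp only [qRatio_zero, map_zero, zero_add, pow_one, zero_mul, sub_zero, mul_one] at h5
    have h6 := qBinomialSeries_mul_eulerSeries 0 x
    have h7 := qBinomialSeries_mul_eulerSeries x x⁻¹
    have h8 : (fun i : ℕ => if i < 1 then (0 : ℂ) else 0 * x) = 0 := by ext; simp
    have h9 := eulerSeries_split 1 1
    rw [h8, eulerSeries_zero] at h6
    rw [mul_inv_cancel₀ hx] at h7
    have h10 : (fun i : ℕ => if i < 1 then (0 : ℂ) else (1 : ℕ → ℂ) i) =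
        (fun i : ℕ => if i < 1 then (0 : ℂ) else 1) := by ext; simp
    rw [h10, ← h7] at h9
    have h11 : eulerPartial 1 1 = 1 - X := by simp [eulerPartial]
    rw [h11] at h9
    rw [h9, map_sub, map_one]
    have h12 : (crankSeries x + (C x - 1) * X) * eulerSeries (fun _ => x) =
        (1 - X) * qBinomialSeries x x⁻¹ 0 := by
      linear_combination h4 + (1 - X) * h6 - C x * X * eulerSeries (fun _ => x) * h5
    rw [h12]; ring
  · rw [add_mul, mul_assoc (C x⁻¹ ^ (L + 1)), onesSeries_mul, boundedSeries_sub]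
    ring

/-- The coefficients `∑_k M(k, p, n) x^k`. -/
def crankCoeff (p : ℕ) (x : ℂ) (n : ℕ) : ℂ :=
  ∑ k ∈ range p, (crankCount k p n : ℂ) * x ^ k

lemma sum_modEq {p : ℕ} (hp : 0 < p) {x : ℂ} (hx : x ^ p = 1) (c : ℤ) :
    ∑ k ∈ range p, (if c ≡ (k : ℤ) [ZMOD p] then (1 : ℂ) else 0) * x ^ k = x ^ c := by
  have hx0 : x ≠ 0 := by rintro rfl; simp [hp.ne'] at hx
  have hp' : (p : ℤ) ≠ 0 := by exact_mod_cast hp.ne'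
  obtain ⟨r, hr⟩ := Int.eq_ofNat_of_zero_le (Int.emod_nonneg c hp')
  have hrp : r < p := by
    have := Int.emod_lt_of_pos c (b := p) (by exact_mod_cast hp)
    lia
  have key : ∀ k ∈ range p, (c ≡ (k : ℤ) [ZMOD p] ↔ k = r) := by
    intro k hk
    rw [Int.ModEq, hr, Int.emod_eq_of_lt (by lia) (by exact_mod_cast mem_range.mp hk)]
    constructor <;> intro h <;> lia
  rw [sum_eq_single r]
  · rw [if_pos ((key r (mem_range.mpr hrp)).mpr rfl), one_mul]
    conv_rhs => rw [← Int.emod_add_mul_ediv c p, hr]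
    rw [zpow_add₀ hx0, zpow_mul, zpow_natCast, zpow_natCast, hx, one_zpow, mul_one]
  · intro k hk hkr
    rw [if_neg ((key k hk).not.mpr hkr), zero_mul]
  · intro h
    exact absurd (mem_range.mpr hrp) h

/-- The only discrepancy is at n = 1: the partition 1 has combinatorial crank -1 and contributes
x⁻¹, whereas the convention prescribes -1 + x + x⁻¹. -/
lemma mk_crankCoeff {p : ℕ} (hp : 0 < p) {x : ℂ} (hx : x ^ p = 1) :
    PowerSeries.mk (crankCoeff p x) = crankSeries x + C (x - 1) * X := by
  ext n
  rw [coeff_mk, map_add, crankSeries, coeff_mk, coeff_C_mul, coeff_X, crankCoeff]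
  by_cases hn : n = 1
  · subst hn
    have h : ∑ P : Nat.Partition 1, x ^ crank P = x⁻¹ := by
      simp [crank, Multiset.filter_singleton]
    rw [h]
    simp only [crankCount, if_true]
    push_cast
    simp only [add_mul, sub_mul, sum_add_distrib, sum_sub_distrib, sum_modEq hp hx]
    simp
    ring
  · rw [if_neg hn, mul_zero, add_zero]
    simp only [crankCount, if_neg hn]
    simp_rw [← sum_modEq hp hx (crank _)]
    rw [sum_comm]
    refine sum_congr rfl fun k _ => ?_
    rw [← sum_mul, Nat.card_eq_fintype_card, Fintype.card_subtype]
    simp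

theorem mk_crankCoeff_mul {p : ℕ} (hp : 0 < p) {x : ℂ} (hx : x ^ p = 1) :
    PowerSeries.mk (crankCoeff p x) * (eulerSeries (fun _ => x) * eulerSeries (fun _ => x⁻¹)) =
      eulerSeries 1 := by
  rw [mk_crankCoeff hp hx, ← mul_assoc]
  exact crankSeries_mul (by rintro rfl; simp [hp.ne'] at hx)

end CrankGeneratingFunction

/-! ### Power series as holomorphic functions on the unit disc -/

section DiscSeries

open Finset Filter Metric
open scoped PowerSeries.WithPiTopology

/-- On the open unit disc, `F` is the sum of the power series `s`. -/
def IsDiscSum (F : ℂ → ℂ) (s : PowerSeries ℂ) : Prop :=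
  ∀ q : ℂ, ‖q‖ < 1 → HasSum (fun n => s.coeff n * q ^ n) (F q)

lemma IsDiscSum.of_differentiableOn {F : ℂ → ℂ} (hF : DifferentiableOn ℂ F (ball 0 1)) :
    IsDiscSum F (PowerSeries.mk fun n => (n.factorial : ℂ)⁻¹ * iteratedDeriv n F 0) := by
  intro q hq
  convert! Complex.hasSum_taylorSeries_on_ball hF (z := q) (by simpa using hq) using 2 with n
  simp only [PowerSeries.coeff_mk, smul_eq_mul, sub_zero]
  ring

lemma IsDiscSum.unique {F : ℂ → ℂ} {s t : PowerSeries ℂ} (hs : IsDiscSum F s)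
    (ht : IsDiscSum F t) : s = t := by
  have key : ∀ u : PowerSeries ℂ, IsDiscSum F u → HasFPowerSeriesAt F
      (FormalMultilinearSeries.ofScalars ℂ fun n => u.coeff n) 0 := by
    intro u hu
    rw [hasFPowerSeriesAt_iff]
    filter_upwards [ball_mem_nhds (0 : ℂ) one_pos] with z hz
    convert! hu z (by simpa using hz) using 2 with n
    · simp [FormalMultilinearSeries.coeff_ofScalars, mul_comm]
    · simp
  have h := (key s hs).eq_formalMultilinearSeries (key t ht)
  ext n
  have := congrArg (fun p => FormalMultilinearSeries.coeff p n) h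
  simpa [FormalMultilinearSeries.coeff_ofScalars] using this

lemma IsDiscSum.coeff_eq {F : ℂ → ℂ} {s : PowerSeries ℂ} (hF : DifferentiableOn ℂ F (ball 0 1))
    (hs : IsDiscSum F s) (n : ℕ) : s.coeff n = (n.factorial : ℂ)⁻¹ * iteratedDeriv n F 0 := by
  rw [hs.unique (.of_differentiableOn hF), PowerSeries.coeff_mk]

lemma IsDiscSum.mul {F G : ℂ → ℂ} {s t : PowerSeries ℂ} (hs : IsDiscSum F s)
    (ht : IsDiscSum G t) : IsDiscSum (fun q => F q * G q) (s * t) := by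
  intro q hq
  have h1 := (hs q hq).summable.norm
  have h2 := (ht q hq).summable.norm
  have h := tsum_mul_tsum_eq_tsum_sum_antidiagonal_of_summable_norm h1 h2
  rw [(hs q hq).tsum_eq, (ht q hq).tsum_eq] at h
  change HasSum _ (F q * G q)
  rw [h]
  convert! (summable_norm_sum_mul_antidiagonal_of_summable_norm h1 h2).of_norm.hasSum using 2 with n
  rw [PowerSeries.coeff_mul, sum_mul]
  refine sum_congr rfl fun k hk => ?_
  rw [← mem_antidiagonal.mp hk, pow_add]
  ring

lemma IsDiscSum.one_sub_mul_pow (ω : ℂ) (n : ℕ) :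
    IsDiscSum (fun q => 1 - ω * q ^ (n + 1))
      (1 - PowerSeries.C ω * PowerSeries.X ^ (n + 1)) := by
  intro q _
  have h := hasSum_sum_of_ne_finset_zero (s := range (n + 2)) (L := .unconditional ℕ)
    (f := fun k => PowerSeries.coeff k (1 - PowerSeries.C ω * PowerSeries.X ^ (n + 1)) * q ^ k) (by
      intro k hk
      have : n + 2 ≤ k := by simpa using hk
      simp [PowerSeries.coeff_one, PowerSeries.coeff_X_pow, show k ≠ 0 by lia,
        show k ≠ n + 1 by lia])
  convert! h using 1
  rw [sum_range_succ, sum_range_succ']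
  rw [sum_eq_zero fun k hk => by
    simp [PowerSeries.coeff_one, PowerSeries.coeff_X_pow, show k ≠ n by
      have := mem_range.mp hk; lia]]
  simp [PowerSeries.coeff_one, PowerSeries.coeff_X_pow]
  ring

lemma IsDiscSum.prod (F : ℕ → ℂ → ℂ) (s : ℕ → PowerSeries ℂ) (h : ∀ i, IsDiscSum (F i) (s i))
    (t : Finset ℕ) : IsDiscSum (fun q => ∏ i ∈ t, F i q) (∏ i ∈ t, s i) := by
  induction t using Finset.induction_on with
  | empty =>
    intro q _
    simp only [prod_empty]
    convert! hasSum_single (f := fun n => PowerSeries.coeff n (1 : PowerSeries ℂ) * q ^ n) 0 ?_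
      using 1
    · simp
    · intro n hn; simp [PowerSeries.coeff_one, hn]
  | insert a t ha ih =>
    simp_rw [prod_insert ha]
    exact (h a).mul ih

lemma tendsto_iteratedDeriv {ι : Type*} {φ : Filter ι} [NeBot φ] {U : Set ℂ} (hU : IsOpen U)
    (n : ℕ) {F : ι → ℂ → ℂ} {f : ℂ → ℂ} (hf : TendstoLocallyUniformlyOn F f φ U)
    (hF : ∀ i, DifferentiableOn ℂ (F i) U) :
    TendstoLocallyUniformlyOn (fun i => iteratedDeriv n (F i)) (iteratedDeriv n f) φ U := by
  induction n generalizing F f with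
  | zero => simpa using hf
  | succ n ih =>
    simp_rw [iteratedDeriv_succ']
    exact ih (hf.deriv (.of_forall hF) hU) fun i => (hF i).deriv hU

/-- By Weierstrass, locally uniform limits commute with derivatives, so the Taylor coefficients
converge to those of the limit. This transfers a formal infinite product to the analytic one. -/
lemma IsDiscSum.of_tendsto {ι : Type*} {φ : Filter ι} [NeBot φ] {F : ι → ℂ → ℂ} {f : ℂ → ℂ}
    {s : ι → PowerSeries ℂ} {t : PowerSeries ℂ} (hF : ∀ i, DifferentiableOn ℂ (F i) (ball 0 1))
    (hs : ∀ i, IsDiscSum (F i) (s i)) (hf : TendstoLocallyUniformlyOn F f φ (ball 0 1))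
    (ht : Tendsto s φ (nhds t)) : IsDiscSum f t := by
  have hfd : DifferentiableOn ℂ f (ball 0 1) := hf.differentiableOn (.of_forall hF) isOpen_ball
  convert! IsDiscSum.of_differentiableOn hfd using 1
  ext n
  have h1 := (PowerSeries.WithPiTopology.tendsto_iff_coeff_tendsto ..).mp ht n
  have h2 := ((tendsto_iteratedDeriv isOpen_ball n hf hF).tendsto_at
    (mem_ball_self one_pos)).const_mul (n.factorial : ℂ)⁻¹
  rw [PowerSeries.coeff_mk]
  exact tendsto_nhds_unique h1 (h2.congr fun i => ((hs i).coeff_eq (hF i) n).symm)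

end DiscSeries

/-! ### Convergence and non-vanishing of infinite products -/

section InfiniteProducts

open Finset Filter Metric
open scoped PowerSeries.WithPiTopology

lemma hasProdLocallyUniformlyOn_one_sub {U : Set ℂ} (hU : IsOpen U) (f : ℕ → ℂ → ℂ)
    (hf : ∀ n, DifferentiableOn ℂ (f n) U)
    (hb : ∀ K ⊆ U, IsCompact K → ∃ u : ℕ → ℝ, Summable u ∧ ∀ n, ∀ x ∈ K, ‖f n x‖ ≤ u n) :
    HasProdLocallyUniformlyOn (fun n x => 1 - f n x) (fun x => ∏' n, (1 - f n x)) U := by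
  simp_rw [sub_eq_add_neg]
  refine hasProdLocallyUniformlyOn_of_forall_compact hU fun K hK hcK => ?_
  obtain ⟨u, hu, hb⟩ := hb K hK hcK
  exact hu.hasProdUniformlyOn_nat_one_add hcK (.of_forall fun n x hx => by simpa using hb n x hx)
    fun n => ((hf n).mono hK).continuousOn.neg

lemma differentiableOn_prod {U : Set ℂ} {f : ℕ → ℂ → ℂ} (hf : ∀ n, DifferentiableOn ℂ (f n) U)
    (s : Finset ℕ) : DifferentiableOn ℂ (fun x => ∏ n ∈ s, (1 - f n x)) U :=
  DifferentiableOn.fun_finsetProd fun n _ => (hf n).const_sub 1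

lemma differentiableOn_tprod_one_sub {U : Set ℂ} (hU : IsOpen U) (f : ℕ → ℂ → ℂ)
    (hf : ∀ n, DifferentiableOn ℂ (f n) U)
    (hb : ∀ K ⊆ U, IsCompact K → ∃ u : ℕ → ℝ, Summable u ∧ ∀ n, ∀ x ∈ K, ‖f n x‖ ≤ u n) :
    DifferentiableOn ℂ (fun x => ∏' n, (1 - f n x)) U :=
  (hasProdLocallyUniformlyOn_one_sub hU f hf hb).differentiableOn
    (.of_forall fun s => differentiableOn_prod hf s) hU

/-- The product `∏ (1 - ω w^{e_n})`. -/
def powProd (ω : ℂ) (e : ℕ → ℕ) (w : ℂ) : ℂ := ∏' n, (1 - ω * w ^ e n)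

variable {ω : ℂ} {e : ℕ → ℕ}

/-- A compact subset of the disc lies in a disc of radius r < 1, and growth of the exponents gives a
geometric majorant. -/
lemma powProd_bound (he : ∀ n, n < e n) (K : Set ℂ) (hK : K ⊆ ball 0 1)
    (hcK : IsCompact K) :
    ∃ u : ℕ → ℝ, Summable u ∧ ∀ n, ∀ w ∈ K, ‖ω * w ^ e n‖ ≤ u n := by
  obtain ⟨r, hr0, hr1, hr⟩ : ∃ r : ℝ, 0 ≤ r ∧ r < 1 ∧ ∀ w ∈ K, ‖w‖ ≤ r := by
    rcases K.eq_empty_or_nonempty with rfl | hne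
    · exact ⟨0, le_rfl, one_pos, by simp⟩
    · obtain ⟨w, hw, hmax⟩ := hcK.exists_isMaxOn hne continuous_norm.continuousOn
      exact ⟨‖w‖, norm_nonneg _, by simpa using hK hw, fun v hv => hmax hv⟩
  refine ⟨fun n => ‖ω‖ * r ^ n, (summable_geometric_of_lt_one hr0 hr1).mul_left _,
    fun n w hw => ?_⟩
  rw [norm_mul, norm_pow]
  exact mul_le_mul_of_nonneg_left ((pow_le_pow_left₀ (norm_nonneg _) (hr w hw) _).trans
    (pow_le_pow_of_le_one hr0 hr1.le (he n).le)) (norm_nonneg _)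

lemma differentiableOn_powProd (he : ∀ n, n < e n) :
    DifferentiableOn ℂ (powProd ω e) (ball 0 1) :=
  differentiableOn_tprod_one_sub isOpen_ball _ (fun n => by fun_prop) (powProd_bound he)

lemma one_sub_mul_ne_zero {a w : ℂ} (ha : ‖a‖ ≤ 1) (hw : ‖w‖ < 1) : 1 - a * w ≠ 0 := by
  intro h
  have h1 : ‖a * w‖ = 1 := by rw [← sub_eq_zero.mp h, norm_one]
  rw [norm_mul] at h1
  nlinarith [norm_nonneg a, norm_nonneg w]

lemma one_sub_mul_pow_ne_zero {a w : ℂ} {k : ℕ} (hk : k ≠ 0) (ha : ‖a‖ ≤ 1) (hw : ‖w‖ < 1) :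
    1 - a * w ^ k ≠ 0 :=
  one_sub_mul_ne_zero ha (by rw [norm_pow]; exact pow_lt_one₀ (norm_nonneg _) hw hk)

lemma powProd_ne_zero (he : ∀ n, n < e n) (hω : ‖ω‖ ≤ 1) {w : ℂ} (hw : ‖w‖ < 1) :
    powProd ω e w ≠ 0 := by
  obtain ⟨u, hu, hb⟩ := powProd_bound (ω := ω) he {w} (by simpa using hw) isCompact_singleton
  simp_rw [powProd, sub_eq_add_neg]
  refine tprod_one_add_ne_zero_of_summable (fun n => ?_) ?_
  · rw [← sub_eq_add_neg]
    exact one_sub_mul_pow_ne_zero (by have := he n; lia) hω hw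
  · exact Summable.of_nonneg_of_le (fun _ => norm_nonneg _)
      (fun n => by simpa using hb n w rfl) hu

lemma isDiscSum_powProd (ω : ℂ) :
    IsDiscSum (powProd ω fun n => n + 1) (eulerSeries fun _ => ω) := by
  have he : ∀ n : ℕ, n < n + 1 := fun n => n.lt_succ_self
  have h := hasProdLocallyUniformlyOn_one_sub isOpen_ball (fun n w => ω * w ^ (n + 1))
    (fun n => by fun_prop) (powProd_bound he)
  refine IsDiscSum.of_tendsto (F := fun s w => ∏ n ∈ s, (1 - ω * w ^ (n + 1)))
    (fun s => differentiableOn_prod (fun n => by fun_prop) s)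
    (fun s => IsDiscSum.prod _ _ (fun n => IsDiscSum.one_sub_mul_pow ω n) s) h
    (hasProd_eulerSeries _)

/-- No growth estimate for the crank counts is needed. The quotient is holomorphic on the disc, so
its Taylor series converges there; that series and the crank series satisfy the same formal product
identity, and nonzero factors cancel in ℂ⟦X⟧. -/
theorem hasSum_crankCoeff {p : ℕ} (hp : 0 < p) {x : ℂ} (hx : x ^ p = 1) {q : ℂ} (hq : ‖q‖ < 1) :
    HasSum (fun n => crankCoeff p x n * q ^ n)
      (powProd 1 (fun n => n + 1) q /
        (powProd x (fun n => n + 1) q * powProd x⁻¹ (fun n => n + 1) q)) := by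
  have he : ∀ n : ℕ, n < n + 1 := fun n => n.lt_succ_self
  have hx1 : ‖x‖ = 1 := Complex.norm_eq_one_of_pow_eq_one hx hp.ne'
  have hx2 : ‖x⁻¹‖ = 1 := by rw [norm_inv, hx1, inv_one]
  have hne : ∀ w ∈ ball (0 : ℂ) 1,
      powProd x (fun n => n + 1) w * powProd x⁻¹ (fun n => n + 1) w ≠ 0 := fun w hw =>
    mul_ne_zero (powProd_ne_zero he hx1.le (by simpa using hw))
      (powProd_ne_zero he hx2.le (by simpa using hw))
  have hd := (differentiableOn_powProd (ω := 1) he).div ((differentiableOn_powProd (ω := x) he).mul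
    (differentiableOn_powProd (ω := x⁻¹) he)) hne
  have h1 := IsDiscSum.of_differentiableOn hd
  have h2 := (isDiscSum_powProd x).mul (isDiscSum_powProd x⁻¹)
  have h3 := h1.mul h2
  have h4 : IsDiscSum (powProd 1 fun n => n + 1) _ := fun w hw => by
    convert! h3 w hw using 1
    exact (div_mul_cancel₀ _ (hne w (by simpa using hw))).symm
  have h5 := h4.unique (isDiscSum_powProd 1)
  have h6 : PowerSeries.mk (crankCoeff p x) = _ := mul_right_cancel₀
    (mul_ne_zero (eulerSeries_ne_zero _) (eulerSeries_ne_zero _))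
    ((mk_crankCoeff_mul hp hx).trans h5.symm)
  rw [← h6] at h1
  simpa using h1 q hq

end InfiniteProducts

/-! ### Uniqueness of theta functions by Liouville's theorem -/

section Liouville

open Filter Topology

/-- An entire function is determined by its quasi-periodicity under the lattice `ℤτ + ℤ` and its
derivative at `0` among the functions with zeros (at most) at the lattice points, if these zeros
are simple. -/
theorem eq_of_quasiPeriodic {τ : ℂ} (hτ : 0 < τ.im) {f g : ℂ → ℂ} {μ : ℂ → ℂ} {c : ℂ}
    (hc : c ≠ 0) (hμ : ∀ w, μ w ≠ 0) (hf : Differentiable ℂ f) (hg : Differentiable ℂ g)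
    (hf1 : ∀ w, f (w + 1) = -f w) (hg1 : ∀ w, g (w + 1) = -g w)
    (hfτ : ∀ w, f (w + τ) = μ w * f w) (hgτ : ∀ w, g (w + τ) = μ w * g w)
    (hf0 : f 0 = 0) (hg0 : g 0 = 0) (hfc : HasDerivAt f c 0) (hgc : HasDerivAt g c 0)
    (hzero : ∀ w, f w = 0 → ∃ m n : ℤ, w = m * τ + n) : f = g := by
  classical
  -- The zeros of f are lattice points, and 1 is the limit of g/f there: both derivatives at 0 equal
  -- c, and the quotient is doubly periodic.
  set h : ℂ → ℂ := fun w => if f w = 0 then 1 else g w / f w with hh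
  have hp1 : Function.Periodic h 1 := by
    intro w
    simp only [hh, hf1, hg1, neg_eq_zero, neg_div_neg_eq]
  have hpτ : Function.Periodic h τ := by
    intro w
    simp only [hh, hfτ, hgτ, mul_eq_zero, hμ, false_or, mul_div_mul_left _ _ (hμ w)]
  have hp : ∀ (w : ℂ) (m n : ℤ), h (w + (m * τ + n)) = h w := by
    intro w m n
    have h1 := hp1.int_mul n (w + m * τ)
    rw [mul_one] at h1
    rw [← add_assoc, h1]
    exact hpτ.int_mul m w
  have hd0 : DifferentiableAt ℂ h 0 := by
    have hne : ∀ᶠ w in 𝓝[≠] (0 : ℂ), f w ≠ 0 := hfc.eventually_ne hc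
    refine (Complex.analyticAt_of_differentiable_on_punctured_nhds_of_continuousAt ?_
      ?_).differentiableAt
    · filter_upwards [hne] with w hw
      have : h =ᶠ[𝓝 w] fun v => g v / f v := by
        filter_upwards [hf.continuous.continuousAt.eventually_ne hw] with v hv
        simp [hh, hv]
      exact this.differentiableAt_iff.mpr ((hg w).div (hf w) hw)
    · rw [continuousAt_iff_punctured_nhds]
      have h1 := hgc.tendsto_slope.div hfc.tendsto_slope hc
      rw [div_self hc] at h1
      have h2 : h 0 = 1 := by simp [hh, hf0]
      rw [h2]
      refine h1.congr' ?_
      filter_upwards [hne, self_mem_nhdsWithin] with w hw hw0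
      have hw0' : w ≠ 0 := hw0
      simp only [Pi.div_apply, slope_def_field, hf0, hg0, sub_zero, hh, if_neg hw]
      rw [div_div_div_cancel_right₀ hw0']
  have hd : Differentiable ℂ h := by
    intro w
    by_cases hw : f w = 0
    · obtain ⟨m, n, rfl⟩ := hzero w hw
      have : h = fun w => h (w + -(m * τ + n)) := by
        ext v
        have := hp v (-m) (-n)
        push_cast at this
        rw [← this]; ring_nf
      rw [this]
      have h2 : DifferentiableAt ℂ h ((m * τ + n) + -(m * τ + n)) := by rwa [add_neg_cancel]
      exact DifferentiableAt.comp (f := fun w : ℂ => w + -(m * τ + n)) (m * τ + n : ℂ) h2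
        (by fun_prop)
    · have : h =ᶠ[𝓝 w] fun v => g v / f v := by
        filter_upwards [hf.continuous.continuousAt.eventually_ne hw] with v hv
        simp [hh, hv]
      exact this.differentiableAt_iff.mpr ((hg w).div (hf w) hw)
  -- By double periodicity all values are taken on a compact period parallelogram.
  have hb : Bornology.IsBounded (Set.range h) := by
    have hK : IsCompact ((fun st : ℝ × ℝ => (st.1 * τ + st.2 : ℂ)) ''
        (Set.Icc 0 1 ×ˢ Set.Icc 0 1)) :=
      (isCompact_Icc.prod isCompact_Icc).image (by fun_prop)
    refine (hK.image hd.continuous).isBounded.subset ?_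
    rintro _ ⟨w, rfl⟩
    set s := w.im / τ.im with hs
    set t := w.re - s * τ.re with ht
    have hw : w = s * τ + t := by
      apply Complex.ext
      · simp [ht]
      · simp [hs, hτ.ne']
    refine ⟨_, ⟨(Int.fract s, Int.fract t), ⟨⟨Int.fract_nonneg s, (Int.fract_lt_one s).le⟩,
      ⟨Int.fract_nonneg t, (Int.fract_lt_one t).le⟩⟩, rfl⟩, ?_⟩
    rw [← hp _ ⌊s⌋ ⌊t⌋, hw]
    congr 1
    conv_rhs => rw [← Int.floor_add_fract s, ← Int.floor_add_fract t]
    push_cast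
    ring
  have hone : ∀ w, h w = 1 := fun w => by
    rw [hd.apply_eq_apply_of_bounded hb w 0]; simp [hh, hf0]
  have hgz : ∀ m n : ℤ, g (m * τ + n) = 0 := by
    intro m n
    have q1 : Function.Periodic (fun w => g w = 0) 1 := fun w => by simp [hg1]
    have qτ : Function.Periodic (fun w => g w = 0) τ := fun w => by simp [hgτ, hμ]
    have h1 := q1.int_mul n (m * τ)
    have h2 := qτ.int_mul m 0
    simp only [mul_one, zero_add, hg0] at h1 h2
    rw [h1, h2]; trivial
  ext w
  by_cases hw : f w = 0
  · obtain ⟨m, n, rfl⟩ := hzero w hw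
    rw [hw, hgz]
  · have := hone w
    simp only [hh, if_neg hw] at this
    exact ((div_eq_one_iff_eq hw).mp this).symm

end Liouville

/-! ### The q-Pochhammer product as a function of x -/

section JacobiProduct

open Metric

/-- The product `∏_{n ≥ 1} (1 - x q^n)`. -/
abbrev qPochhammer (x q : ℂ) : ℂ := powProd x (fun n => n + 1) q

lemma qPochhammer_bound {q : ℂ} (hq : ‖q‖ < 1) (K : Set ℂ) (hcK : IsCompact K) :
    ∃ u : ℕ → ℝ, Summable u ∧ ∀ n : ℕ, ∀ x ∈ K, ‖x * q ^ (n + 1)‖ ≤ u n := by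
  obtain ⟨M, hM⟩ := hcK.exists_bound_of_continuousOn (f := fun x => x) continuousOn_id
  refine ⟨fun n => M * ‖q‖ ^ (n + 1), ((summable_nat_add_iff 1).mpr
    (summable_geometric_of_lt_one (norm_nonneg _) hq)).mul_left _, fun n x hx => ?_⟩
  rw [norm_mul, norm_pow]
  exact mul_le_mul_of_nonneg_right (hM x hx) (by positivity)

lemma differentiable_qPochhammer {q : ℂ} (hq : ‖q‖ < 1) :
    Differentiable ℂ fun x => qPochhammer x q := by
  rw [← differentiableOn_univ]
  exact differentiableOn_tprod_one_sub isOpen_univ _ (fun n => by fun_prop)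
    fun K _ hK => qPochhammer_bound hq K hK

lemma summable_qPochhammer (x : ℂ) {q : ℂ} (hq : ‖q‖ < 1) :
    Summable fun n : ℕ => ‖-(x * q ^ (n + 1))‖ := by
  simp only [norm_neg, norm_mul, norm_pow]
  exact ((summable_nat_add_iff 1).mpr
    (summable_geometric_of_lt_one (norm_nonneg _) hq)).mul_left _

lemma qPochhammer_eq_mul (x : ℂ) {q : ℂ} (hq : ‖q‖ < 1) :
    qPochhammer x q = (1 - x * q) * qPochhammer (x * q) q := by
  have h := tprod_eq_zero_mul' (f := fun n : ℕ => 1 - x * q ^ (n + 1)) (by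
    have := multipliable_one_add_of_summable (summable_qPochhammer (x * q) hq)
    refine this.congr fun n => ?_
    ring)
  simp only [qPochhammer, powProd]
  rw [h]
  congr 1
  · ring
  · exact tprod_congr fun n => by ring

lemma exists_of_qPochhammer_eq_zero {x q : ℂ} (hq : ‖q‖ < 1) (h : qPochhammer x q = 0) :
    ∃ n : ℕ, x * q ^ (n + 1) = 1 := by
  by_contra! hne
  refine tprod_one_add_ne_zero_of_summable (f := fun n : ℕ => -(x * q ^ (n + 1))) (fun n => ?_)
    (summable_qPochhammer x hq) ?_
  · rw [← sub_eq_add_neg, sub_ne_zero]; exact (hne n).symm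
  · simpa [qPochhammer, powProd, sub_eq_add_neg] using h

end JacobiProduct

/-! ### The theta product, its inversion formula, and Klein forms -/

section KleinForm

open Complex Real

/-- The nome `e^{2πiz}`. -/
def nome (z : ℂ) : ℂ := cexp (2 * π * I * z)

lemma nome_add (a b : ℂ) : nome (a + b) = nome a * nome b := by
  rw [nome, mul_add, Complex.exp_add]; rfl

lemma nome_neg (a : ℂ) : nome (-a) = (nome a)⁻¹ := by
  rw [nome, mul_neg, Complex.exp_neg]; rfl

lemma nome_ne_zero (a : ℂ) : nome a ≠ 0 := Complex.exp_ne_zero _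

lemma nome_int (n : ℤ) : nome n = 1 := by
  rw [nome, Complex.exp_eq_one_iff]
  exact ⟨n, by ring⟩

lemma nome_one : nome 1 = 1 := by simpa using nome_int 1

lemma nome_zero : nome 0 = 1 := by simpa using nome_int 0

lemma nome_nat_mul (n : ℕ) (a : ℂ) : nome (n * a) = nome a ^ n := by
  rw [nome, nome, ← Complex.exp_nat_mul]
  congr 1
  ring

lemma nome_eq_one_iff (a : ℂ) : nome a = 1 ↔ ∃ n : ℤ, a = n := by
  rw [nome, Complex.exp_eq_one_iff]
  refine exists_congr fun n => ?_
  constructor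
  · intro h
    have : (2 * π * I : ℂ) ≠ 0 := Complex.two_pi_I_ne_zero
    exact mul_left_cancel₀ this (by rw [h]; ring)
  · rintro rfl; ring

lemma norm_nome (z : ℂ) : ‖nome z‖ = Real.exp (-2 * π * z.im) := by
  rw [nome, Complex.norm_exp]
  congr 1
  simp

lemma norm_nome_lt_one (z : ℍ) : ‖nome z‖ < 1 := by
  rw [norm_nome, Real.exp_lt_one_iff]
  have := mul_pos Real.two_pi_pos z.im_pos
  simp only [UpperHalfPlane.coe_im]
  linarith

/-- The theta function of the lattice `ℤz + ℤ` in product form, with simple zeros at the lattice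
points. -/
def kleinTheta (w : ℂ) (z : ℍ) : ℂ :=
  (cexp (π * I * w) - cexp (-(π * I * w))) *
    (qPochhammer (nome w) (nome z) * qPochhammer (nome w)⁻¹ (nome z)) /
      qPochhammer 1 (nome z) ^ 2

lemma qPochhammer_one_ne_zero (z : ℍ) : qPochhammer 1 (nome z) ≠ 0 :=
  powProd_ne_zero (fun n => n.lt_succ_self) (by simp) (norm_nome_lt_one z)

lemma exp_pi_sq (w : ℂ) : nome w = cexp (π * I * w) ^ 2 := by
  rw [nome, ← Complex.exp_nat_mul]
  congr 1
  push_cast; ring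

lemma kleinTheta_add_one (w : ℂ) (z : ℍ) : kleinTheta (w + 1) z = -kleinTheta w z := by
  have h1 : cexp (π * I * (w + 1)) = -cexp (π * I * w) := by
    rw [mul_add, Complex.exp_add, mul_one, Complex.exp_pi_mul_I, mul_neg_one]
  have h2 : cexp (-(π * I * (w + 1))) = -cexp (-(π * I * w)) := by
    rw [Complex.exp_neg, h1, Complex.exp_neg, inv_neg]
  rw [kleinTheta, kleinTheta, nome_add, nome_one, mul_one, h1, h2]
  ring

lemma kleinTheta_add_tau (w : ℂ) (z : ℍ) :
    kleinTheta (w + z) z = -cexp (-(π * I * z) - 2 * π * I * w) * kleinTheta w z := by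
  have hq := norm_nome_lt_one z
  have hq0 := nome_ne_zero z
  have hx0 := nome_ne_zero w
  have e1 := qPochhammer_eq_mul (nome w) hq
  have e2 := qPochhammer_eq_mul ((nome w)⁻¹ * (nome z)⁻¹) hq
  rw [inv_mul_cancel_right₀ hq0] at e2
  rw [kleinTheta, kleinTheta, nome_add, mul_inv, e2, e1]
  set A := qPochhammer (nome w * nome z) (nome z)
  set B := qPochhammer (nome w)⁻¹ (nome z)
  set a := cexp (π * I * w) with ha
  set t := cexp (π * I * z) with ht
  have ha0 : a ≠ 0 := Complex.exp_ne_zero _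
  have ht0 : t ≠ 0 := Complex.exp_ne_zero _
  have h1 : cexp (π * I * (w + z)) = a * t := by rw [mul_add, Complex.exp_add]
  have h2 : cexp (-(π * I * z) - 2 * π * I * w) = t⁻¹ * (a ^ 2)⁻¹ := by
    rw [sub_eq_add_neg, Complex.exp_add, Complex.exp_neg, Complex.exp_neg, ← exp_pi_sq]; rfl
  rw [Complex.exp_neg, Complex.exp_neg, h1, h2, exp_pi_sq w, exp_pi_sq z, ← ha, ← ht]
  field_simp
  ring

lemma differentiable_kleinTheta (z : ℍ) : Differentiable ℂ fun w => kleinTheta w z := by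
  have h1 := differentiable_qPochhammer (norm_nome_lt_one z)
  have hn : Differentiable ℂ nome := by unfold nome; fun_prop
  have h2 : Differentiable ℂ fun w => qPochhammer (nome w) (nome z) := h1.comp hn
  have h3 : Differentiable ℂ fun w => qPochhammer (nome w)⁻¹ (nome z) :=
    h1.comp (hn.inv nome_ne_zero)
  unfold kleinTheta
  exact (Differentiable.mul (by fun_prop) (h2.mul h3)).div_const _

lemma kleinTheta_zero (z : ℍ) : kleinTheta 0 z = 0 := by simp [kleinTheta]

lemma hasDerivAt_kleinTheta (z : ℍ) : HasDerivAt (fun w => kleinTheta w z) (2 * π * I) 0 := by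
  have h1 := differentiable_qPochhammer (norm_nome_lt_one z)
  have hn : Differentiable ℂ nome := by unfold nome; fun_prop
  have h2 : Differentiable ℂ fun w => qPochhammer (nome w) (nome z) := h1.comp hn
  have h3 : Differentiable ℂ fun w => qPochhammer (nome w)⁻¹ (nome z) :=
    h1.comp (hn.inv nome_ne_zero)
  have h4 : HasDerivAt (fun w : ℂ => cexp (π * I * w) - cexp (-(π * I * w))) (2 * π * I) 0 := by
    have e1 := ((hasDerivAt_id (0 : ℂ)).const_mul (π * I : ℂ)).cexp
    have e2 := ((hasDerivAt_id (0 : ℂ)).const_mul (π * I : ℂ)).neg.cexp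
    convert! e1.sub e2 using 1
    simp
    ring
  have h5 := (h4.mul ((h2.mul h3) 0).hasDerivAt).div_const (qPochhammer 1 (nome z) ^ 2)
  convert! h5 using 1
  have := qPochhammer_one_ne_zero z
  simp [nome_zero]
  field_simp

lemma exists_of_kleinTheta_eq_zero {w : ℂ} {z : ℍ} (h : kleinTheta w z = 0) :
    ∃ m n : ℤ, w = m * z + n := by
  have hq := norm_nome_lt_one z
  rw [kleinTheta, div_eq_zero_iff, or_iff_left (pow_ne_zero 2 (qPochhammer_one_ne_zero z)),
    mul_eq_zero, mul_eq_zero] at h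
  rcases h with h | h | h
  · have h1 : nome w = 1 := by
      rw [exp_pi_sq, sq]
      nth_rewrite 2 [sub_eq_zero.mp h]
      rw [← Complex.exp_add, add_neg_cancel, Complex.exp_zero]
    obtain ⟨n, hn⟩ := (nome_eq_one_iff w).mp h1
    exact ⟨0, n, by rw [hn]; simp⟩
  · obtain ⟨k, hk⟩ := exists_of_qPochhammer_eq_zero hq h
    rw [← nome_nat_mul, ← nome_add] at hk
    obtain ⟨n, hn⟩ := (nome_eq_one_iff _).mp hk
    exact ⟨-(k + 1 : ℕ), n, by rw [← hn]; push_cast; ring⟩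
  · obtain ⟨k, hk⟩ := exists_of_qPochhammer_eq_zero hq h
    rw [← nome_nat_mul, ← nome_neg, ← nome_add] at hk
    obtain ⟨n, hn⟩ := (nome_eq_one_iff _).mp hk
    exact ⟨(k + 1 : ℕ), -n, by push_cast; rw [← hn]; push_cast; ring⟩

lemma kleinTheta_T (w : ℂ) (z : ℍ) : kleinTheta w (ModularGroup.T • z) = kleinTheta w z := by
  have : nome (ModularGroup.T • z : ℍ) = nome z := by
    rw [UpperHalfPlane.modular_T_smul, UpperHalfPlane.coe_vadd, nome_add]
    simp [nome_one]
  simp only [kleinTheta, this]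

/-- After multiplication by z e^{-πiw²/z}, the theta function of the lattice rescaled by 1/z has the
same quasi-periods and the same derivative at 0 as the original one, so `eq_of_quasiPeriodic`
applies. -/
lemma kleinTheta_S (w : ℂ) (z : ℍ) :
    kleinTheta (w / z) (ModularGroup.S • z) =
      (z : ℂ)⁻¹ * cexp (π * I * w ^ 2 / z) * kleinTheta w z := by
  have hz := z.ne_zero
  set z' : ℍ := ModularGroup.S • z with hz'
  have hz'c : (z' : ℂ) = -1 / z := by
    rw [hz', UpperHalfPlane.modular_S_smul]
    simp [neg_div, inv_neg]
  have key : (fun w => kleinTheta w z) =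
      fun w => z * cexp (-(π * I * w ^ 2 / z)) * kleinTheta (w / z) z' := by
    refine eq_of_quasiPeriodic (τ := z) z.im_pos
      (μ := fun w => -cexp (-(π * I * z) - 2 * π * I * w)) (c := 2 * π * I)
      Complex.two_pi_I_ne_zero (fun w => neg_ne_zero.mpr (Complex.exp_ne_zero _))
      (differentiable_kleinTheta z) ?_ (fun w => kleinTheta_add_one w z) ?_
      (fun w => kleinTheta_add_tau w z) ?_ (kleinTheta_zero z) (by simp [kleinTheta_zero])
      (hasDerivAt_kleinTheta z) ?_ (fun w => exists_of_kleinTheta_eq_zero)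
    · have h1 : Differentiable ℂ fun w : ℂ => kleinTheta (w / z) z' :=
        (differentiable_kleinTheta z').comp (by fun_prop)
      exact Differentiable.mul (by fun_prop) h1
    · intro w
      -- The shift w ↦ w + 1 becomes a shift by 1/z = -z' in the rescaled variable, hence the
      -- quasi-period is used backwards from (w + 1)/z.
      have h1 := kleinTheta_add_tau ((w + 1) / z) z'
      rw [show (w + 1) / (z : ℂ) + z' = w / z by rw [hz'c]; ring] at h1
      rw [h1, ← mul_assoc, ← neg_mul]
      congr 1
      rw [mul_neg, mul_assoc, mul_assoc, ← Complex.exp_add]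
      rw [hz'c]
      field_simp
      ring_nf
    · intro w
      rw [add_div, div_self hz, kleinTheta_add_one, mul_neg, ← mul_assoc, neg_mul, neg_mul, neg_inj]
      congr 1
      rw [mul_left_comm, ← Complex.exp_add]
      congr 2
      field_simp; ring
    · have h1 : HasDerivAt (fun w : ℂ => kleinTheta (w / z) z') (2 * π * I * (1 / z)) 0 := by
        have h2 : HasDerivAt (fun w => kleinTheta w z') (2 * π * I) ((0 : ℂ) / z) := by
          rw [zero_div]; exact hasDerivAt_kleinTheta z'
        exact h2.comp 0 ((hasDerivAt_id (0 : ℂ)).div_const (z : ℂ))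
      have h3 : Differentiable ℂ fun w : ℂ => (z : ℂ) * cexp (-(π * I * w ^ 2 / z)) := by fun_prop
      convert! (h3 0).hasDerivAt.mul h1 using 1
      simp [kleinTheta_zero]
      field_simp
  have h := congrFun key w
  rw [h, Complex.exp_neg]
  have := Complex.exp_ne_zero (π * I * w ^ 2 / z)
  field_simp

/-- The Klein form `𝔨_{(a, b)}`. -/
def kleinForm (a b : ℝ) (z : ℍ) : ℂ :=
  cexp (π * I * a * (a * z + b)) * kleinTheta (a * z + b) z

lemma kleinForm_T (a b : ℝ) (z : ℍ) :
    kleinForm a b (ModularGroup.T • z) = kleinForm a (a + b) z := by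
  rw [kleinForm, kleinTheta_T, kleinForm]
  have : (a : ℂ) * (ModularGroup.T • z : ℍ) + b = a * z + (a + b : ℝ) := by
    rw [UpperHalfPlane.modular_T_smul, UpperHalfPlane.coe_vadd]
    push_cast; ring
  rw [this]

lemma kleinForm_S (a b : ℝ) (z : ℍ) :
    kleinForm a b (ModularGroup.S • z) = (z : ℂ)⁻¹ * kleinForm b (-a) z := by
  have hz := z.ne_zero
  have : (a : ℂ) * (ModularGroup.S • z : ℍ) + b = (b * z + (-a : ℝ)) / z := by
    rw [UpperHalfPlane.modular_S_smul]
    simp only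
    push_cast
    field_simp; ring
  rw [kleinForm, this, kleinTheta_S, kleinForm, ← mul_assoc, mul_left_comm, ← Complex.exp_add,
    mul_assoc]
  congr 3
  push_cast
  field_simp; ring

end KleinForm

/-! ### Rational powers of q and affine maps of the half-plane -/

section QPowers

open Complex Real

lemma qpow_eq_nome (s : ℚ) (z : ℍ) : qpow s z = nome (s * z) := by
  rw [qpow, nome, mul_assoc]

lemma qpow_ne_zero (s : ℚ) (z : ℍ) : qpow s z ≠ 0 := Complex.exp_ne_zero _

lemma qpow_add (s t : ℚ) (z : ℍ) : qpow (s + t) z = qpow s z * qpow t z := by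
  simp only [qpow_eq_nome]
  rw [← nome_add, Rat.cast_add, add_mul]

lemma qpow_neg (s : ℚ) (z : ℍ) : qpow (-s) z = (qpow s z)⁻¹ := by
  simp only [qpow_eq_nome]
  rw [← nome_neg, Rat.cast_neg, neg_mul]

lemma qpow_natCast_mul (n : ℕ) (s : ℚ) (z : ℍ) : qpow (n * s) z = qpow s z ^ n := by
  simp only [qpow_eq_nome]
  rw [← nome_nat_mul, Rat.cast_mul, Rat.cast_natCast, mul_assoc]

lemma qpow_one (z : ℍ) : qpow 1 z = nome z := by simp [qpow_eq_nome]

lemma norm_qpow_lt_one {s : ℚ} (hs : 0 < s) (z : ℍ) : ‖qpow s z‖ < 1 := by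
  rw [qpow_eq_nome, norm_nome, Real.exp_lt_one_iff]
  have h1 : (((s : ℂ) * (z : ℂ)).im : ℝ) = s * z.im := by simp
  rw [h1]
  have : (0 : ℝ) < s := by exact_mod_cast hs
  have := mul_pos this z.im_pos
  nlinarith [Real.pi_pos]

lemma qpow_inv_mem_ball {N : ℕ} (hN : 0 < N) (z : ℍ) :
    qpow (1 / N) z ∈ Metric.ball (0 : ℂ) 1 := by
  simpa using norm_qpow_lt_one (s := (1 : ℚ) / N) (by positivity) z

lemma qpow_inv_pow {N M : ℕ} (hM : 0 < M) (z : ℍ) :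
    qpow (1 / (N * M : ℕ)) z ^ M = qpow (1 / N) z := by
  rw [← qpow_natCast_mul]
  congr 1
  have : (M : ℚ) ≠ 0 := by positivity
  push_cast
  field_simp

/-- The affine map `z ↦ (a z + b) / d` of the upper half-plane. -/
def affineMap {a d : ℕ} (ha : 0 < a) (hd : 0 < d) (b : ℤ) (z : ℍ) : ℍ :=
  ⟨(a * z + b) / d, by
    have : (((a : ℂ) * (z : ℂ) + b) / d).im = a * z.im / d := by
      simp [Complex.div_natCast_im]
    rw [this]
    have := z.im_pos
    positivity⟩

lemma coe_affineMap {a d : ℕ} (ha : 0 < a) (hd : 0 < d) (b : ℤ) (z : ℍ) :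
    (affineMap ha hd b z : ℂ) = (a * z + b) / d := rfl

lemma qpow_affineMap {a d : ℕ} (ha : 0 < a) (hd : 0 < d) (b : ℤ) (s : ℚ) (z : ℍ) :
    qpow s (affineMap ha hd b z) = nome (s * b / d) * qpow (s * a / d) z := by
  rw [qpow_eq_nome, qpow_eq_nome, ← nome_add, coe_affineMap]
  congr 1
  push_cast
  ring

lemma norm_nome_ratCast (s : ℚ) : ‖nome s‖ = 1 := by
  rw [norm_nome]; simp

end QPowers

/-! ### Calculus of orders at infinity -/

section Expansions

open Metric

/-- `g = q^r h(q^{1/N})` with `h` holomorphic on the unit disc. -/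
def HasDiscExpansion (g : ℍ → ℂ) (r : ℚ) (N : ℕ) (h : ℂ → ℂ) : Prop :=
  0 < N ∧ DifferentiableOn ℂ h (ball 0 1) ∧ ∀ z : ℍ, g z = qpow r z * h (qpow (1 / N) z)

/-- The order of `g` at infinity is at least `r`. -/
def OrderGE (g : ℍ → ℂ) (r : ℚ) : Prop := ∃ N h, HasDiscExpansion g r N h

/-- The order of `g` at infinity is exactly `r`. -/
def OrderEq (g : ℍ → ℂ) (r : ℚ) : Prop := ∃ N h, HasDiscExpansion g r N h ∧ h 0 ≠ 0

/-- `g` is `q^r` times a nowhere vanishing holomorphic function of some `q^{1/N}`. -/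
def UnitOrder (g : ℍ → ℂ) (r : ℚ) : Prop :=
  ∃ N h, HasDiscExpansion g r N h ∧ ∀ w ∈ ball (0 : ℂ) 1, h w ≠ 0

lemma mapsTo_pow_ball {M : ℕ} (hM : 0 < M) {c : ℂ} (hc : ‖c‖ = 1) :
    Set.MapsTo (fun w : ℂ => c * w ^ M) (ball 0 1) (ball 0 1) := by
  intro w hw
  simp only [mem_ball, dist_zero_right, norm_mul, hc, one_mul, norm_pow] at hw ⊢
  exact pow_lt_one₀ (norm_nonneg _) hw hM.ne'

lemma HasDiscExpansion.raise {g : ℍ → ℂ} {r : ℚ} {N : ℕ} {h : ℂ → ℂ}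
    (H : HasDiscExpansion g r N h) {M : ℕ} (hM : 0 < M) :
    HasDiscExpansion g r (N * M) fun w => h (w ^ M) := by
  refine ⟨Nat.mul_pos H.1 hM, H.2.1.comp (by fun_prop) ?_, fun z => ?_⟩
  · simpa using mapsTo_pow_ball hM (c := 1) (by simp)
  · simp only [qpow_inv_pow hM]
    exact H.2.2 z

/-- With w = q^{1/(N·den)}, the surplus q^{r' - r} equals w^{N·num}, a monomial that is absorbed
into the disc function. -/
lemma HasDiscExpansion.lower {g : ℍ → ℂ} {r r' : ℚ} {N : ℕ} {h : ℂ → ℂ}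
    (H : HasDiscExpansion g r' N h) (hr : r ≤ r') :
    HasDiscExpansion g r (N * (r' - r).den)
      fun w => w ^ (N * (r' - r).num.toNat) * h (w ^ (r' - r).den) := by
  have hden := (r' - r).den_pos
  have H2 := H.raise hden
  refine ⟨H2.1, (by fun_prop : DifferentiableOn ℂ _ _).mul H2.2.1, fun z => ?_⟩
  rw [H2.2.2 z]
  beta_reduce
  rw [← mul_assoc, ← qpow_natCast_mul (N * _), ← qpow_add]
  congr 2
  have h1 : (((r' - r).num.toNat : ℕ) : ℚ) = (r' - r).num := by
    have : (((r' - r).num.toNat : ℕ) : ℤ) = (r' - r).num :=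
      Int.toNat_of_nonneg (Rat.num_nonneg.mpr (sub_nonneg.mpr hr))
    exact_mod_cast this
  have h2 : ((r' - r).num : ℚ) / (r' - r).den = r' - r := Rat.num_div_den _
  have hN : (N : ℚ) ≠ 0 := by exact_mod_cast H.1.ne'
  have hd : ((r' - r).den : ℚ) ≠ 0 := by exact_mod_cast hden.ne'
  push_cast
  rw [h1]
  calc r' = r + (r' - r) := by ring
    _ = r + ((r' - r).num : ℚ) / (r' - r).den := by rw [h2]
    _ = _ := by field_simp

lemma HasDiscExpansion.add {f g : ℍ → ℂ} {r : ℚ} {N M : ℕ} {h k : ℂ → ℂ}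
    (H : HasDiscExpansion f r N h) (K : HasDiscExpansion g r M k) :
    HasDiscExpansion (fun z => f z + g z) r (N * M) fun w => h (w ^ M) + k (w ^ N) := by
  have H1 := H.raise K.1
  have K1 := K.raise H.1
  rw [mul_comm M N] at K1
  exact ⟨H1.1, H1.2.1.add K1.2.1, fun z => by beta_reduce; rw [H1.2.2, K1.2.2, mul_add]⟩

lemma HasDiscExpansion.mul {f g : ℍ → ℂ} {r s : ℚ} {N M : ℕ} {h k : ℂ → ℂ}
    (H : HasDiscExpansion f r N h) (K : HasDiscExpansion g s M k) :
    HasDiscExpansion (fun z => f z * g z) (r + s) (N * M) fun w => h (w ^ M) * k (w ^ N) := by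
  have H1 := H.raise K.1
  have K1 := K.raise H.1
  rw [mul_comm M N] at K1
  exact ⟨H1.1, H1.2.1.mul K1.2.1, fun z => by beta_reduce; rw [H1.2.2, K1.2.2, qpow_add]; ring⟩

lemma pow_mem_ball {M : ℕ} (hM : 0 < M) {w : ℂ} (hw : w ∈ ball (0 : ℂ) 1) :
    w ^ M ∈ ball (0 : ℂ) 1 := by
  simpa using mapsTo_pow_ball hM (c := 1) (by simp) hw

lemma UnitOrder.mul {f g : ℍ → ℂ} {r s : ℚ} (hf : UnitOrder f r) (hg : UnitOrder g s) :
    UnitOrder (fun z => f z * g z) (r + s) := by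
  obtain ⟨N, h, H, hh⟩ := hf
  obtain ⟨M, k, K, hk⟩ := hg
  exact ⟨_, _, H.mul K, fun w hw =>
    mul_ne_zero (hh _ (pow_mem_ball K.1 hw)) (hk _ (pow_mem_ball H.1 hw))⟩

/-- This is why `UnitOrder` asks for non-vanishing on the whole disc and not only at 0: the
reciprocal must again be holomorphic there. -/
lemma UnitOrder.inv {f : ℍ → ℂ} {r : ℚ} (hf : UnitOrder f r) :
    UnitOrder (fun z => (f z)⁻¹) (-r) := by
  obtain ⟨N, h, H, hh⟩ := hf
  exact ⟨N, fun w => (h w)⁻¹, ⟨H.1, H.2.1.inv hh, fun z => by beta_reduce; rw [H.2.2, mul_inv, qpow_neg]⟩,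
    fun w hw => inv_ne_zero (hh w hw)⟩

lemma UnitOrder.const_mul {f : ℍ → ℂ} {r : ℚ} (hf : UnitOrder f r) {c : ℂ} (hc : c ≠ 0) :
    UnitOrder (fun z => c * f z) r := by
  obtain ⟨N, h, H, hh⟩ := hf
  exact ⟨N, fun w => c * h w, ⟨H.1, H.2.1.const_mul c, fun z => by beta_reduce; rw [H.2.2]; ring⟩,
    fun w hw => mul_ne_zero hc (hh w hw)⟩

lemma UnitOrder.comp_affineMap {f : ℍ → ℂ} {r : ℚ} (hf : UnitOrder f r) {a d : ℕ} (ha : 0 < a)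
    (hd : 0 < d) (b : ℤ) : UnitOrder (fun z => f (affineMap ha hd b z)) (r * a / d) := by
  obtain ⟨N, h, H, hh⟩ := hf
  set c : ℂ := nome ((1 / N : ℚ) * b / d) with hc
  have hc1 : ‖c‖ = 1 := by
    have := norm_nome_ratCast ((1 / N : ℚ) * b / d)
    push_cast at this
    rw [hc]; push_cast; exact this
  have hmap := mapsTo_pow_ball ha hc1
  refine ⟨N * d, fun w => nome (r * b / d) * h (c * w ^ a), ⟨Nat.mul_pos H.1 hd,
    (H.2.1.comp (by fun_prop) hmap).const_mul _, fun z => ?_⟩,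
    fun w hw => mul_ne_zero (nome_ne_zero _) (hh _ (hmap hw))⟩
  beta_reduce
  rw [H.2.2, qpow_affineMap, qpow_affineMap, ← qpow_natCast_mul, ← hc]
  have : (1 / N : ℚ) * a / d = a * (1 / (N * d : ℕ)) := by push_cast; ring
  rw [this]; ring

lemma UnitOrder.orderEq {f : ℍ → ℂ} {r : ℚ} (hf : UnitOrder f r) : OrderEq f r := by
  obtain ⟨N, h, H, hh⟩ := hf
  exact ⟨N, h, H, hh 0 (mem_ball_self one_pos)⟩

lemma OrderEq.orderGE {f : ℍ → ℂ} {r : ℚ} (hf : OrderEq f r) : OrderGE f r := by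
  obtain ⟨N, h, H, _⟩ := hf
  exact ⟨N, h, H⟩

lemma OrderGE.mono {f : ℍ → ℂ} {r r' : ℚ} (hf : OrderGE f r') (hr : r ≤ r') : OrderGE f r := by
  obtain ⟨N, h, H⟩ := hf
  exact ⟨_, _, H.lower hr⟩

lemma OrderGE.add {f g : ℍ → ℂ} {r : ℚ} (hf : OrderGE f r) (hg : OrderGE g r) :
    OrderGE (fun z => f z + g z) r := by
  obtain ⟨N, h, H⟩ := hf
  obtain ⟨M, k, K⟩ := hg
  exact ⟨_, _, H.add K⟩

lemma OrderGE.sum {ι : Type*} (s : Finset ι) {f : ι → ℍ → ℂ} {r : ℚ}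
    (hf : ∀ i ∈ s, OrderGE (f i) r) : OrderGE (fun z => ∑ i ∈ s, f i z) r := by
  classical
  induction s using Finset.induction_on with
  | empty => exact ⟨1, fun _ => 0, one_pos, by fun_prop, fun z => by simp⟩
  | insert i s hi ih =>
    simp_rw [Finset.sum_insert hi]
    exact (hf i (Finset.mem_insert_self i s)).add
      (ih fun j hj => hf j (Finset.mem_insert_of_mem hj))

/-- Written relative to q^r, the second summand carries a positive power of w and cannot affect the
value at w = 0. -/
lemma OrderEq.add {f g : ℍ → ℂ} {r r' : ℚ} (hf : OrderEq f r) (hg : OrderGE g r') (hr : r < r') :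
    OrderEq (fun z => f z + g z) r := by
  obtain ⟨N, h, H, h0⟩ := hf
  obtain ⟨M, k, K⟩ := hg
  refine ⟨_, _, H.add (K.lower hr.le), ?_⟩
  have h1 : M * (r' - r).num.toNat ≠ 0 := by
    have h2 := Rat.num_pos.mpr (sub_pos.mpr hr)
    have h3 := K.1
    exact (Nat.mul_pos h3 (by lia)).ne'
  have h4 := (Nat.mul_pos K.1 (r' - r).den_pos).ne'
  simpa [h1, h4, H.1.ne', zero_pow h4, zero_pow H.1.ne'] using h0

lemma HasDiscExpansion.hasOrderAtInfty {g : ℍ → ℂ} {r : ℚ} {N : ℕ} {h : ℂ → ℂ}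
    (H : HasDiscExpansion g r N h) {s : PowerSeries ℂ} (hs : IsDiscSum h s) {n : ℕ}
    (hn : s.coeff n ≠ 0) (hlt : ∀ i < n, s.coeff i = 0) {m : ℤ} (hm : r = m / N) :
    HasOrderAtInfty g ((r + n / N : ℚ) : WithTop ℚ) := by
  have hN : (N : ℚ) ≠ 0 := by exact_mod_cast H.1.ne'
  refine Or.inr ⟨N, m + n, fun j => s.coeff (j + n), H.1, by simpa using hn, ?_, fun z => ?_⟩
  · have : r + n / N = ((m + n : ℤ) : ℚ) / N := by rw [hm]; push_cast; rw [add_div]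
    rw [this]
  · have h1 := hs (qpow (1 / N) z) (by simpa using qpow_inv_mem_ball H.1 z)
    have h2 := ((hasSum_nat_add_iff' n).mpr h1).mul_left (qpow r z)
    rw [Finset.sum_eq_zero fun i hi => by rw [hlt i (Finset.mem_range.mp hi), zero_mul], sub_zero,
      ← H.2.2 z] at h2
    convert! h2 using 2 with j
    rw [mul_left_comm, ← qpow_natCast_mul, ← qpow_add, hm]
    congr 2
    push_cast
    field_simp
    ring

lemma HasDiscExpansion.exists_eq_int_div {g : ℍ → ℂ} {r : ℚ} {N : ℕ} {h : ℂ → ℂ}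
    (H : HasDiscExpansion g r N h) :
    ∃ m : ℤ, r = m / (N * r.den : ℕ) := by
  refine ⟨r.num * N, ?_⟩
  have hN : (N : ℚ) ≠ 0 := by exact_mod_cast H.1.ne'
  have := r.den_pos
  push_cast
  conv_lhs => rw [← Rat.num_div_den r]
  field_simp

lemma OrderEq.hasOrderAtInfty {g : ℍ → ℂ} {r : ℚ} (hg : OrderEq g r) :
    HasOrderAtInfty g (r : WithTop ℚ) := by
  obtain ⟨N, h, H, h0⟩ := hg
  obtain ⟨m, hm⟩ := H.exists_eq_int_div
  -- `HasOrderAtInfty` wants the leading exponent and the step over one common denominator, here N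
  -- times that of r.
  have H1 := H.raise r.den_pos
  have hs := IsDiscSum.of_differentiableOn H1.2.1
  have := H1.hasOrderAtInfty hs (n := 0) (by simpa [r.den_pos.ne'] using h0) (by simp) hm
  simpa using this

lemma OrderGE.exists_hasOrderAtInfty {g : ℍ → ℂ} {r : ℚ} (hg : OrderGE g r) :
    ∃ r' : WithTop ℚ, (r : WithTop ℚ) ≤ r' ∧ HasOrderAtInfty g r' := by
  classical
  obtain ⟨N, h, H⟩ := hg
  obtain ⟨m, hm⟩ := H.exists_eq_int_div
  have H1 := H.raise r.den_pos
  have hs := IsDiscSum.of_differentiableOn H1.2.1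
  set s := PowerSeries.mk fun n => (n.factorial : ℂ)⁻¹ * iteratedDeriv n (fun w => h (w ^ r.den)) 0
  by_cases h0 : ∃ n, s.coeff n ≠ 0
  · refine ⟨_, ?_, H1.hasOrderAtInfty hs (Nat.find_spec h0)
      (fun i hi => not_not.mp (Nat.find_min h0 hi)) hm⟩
    rw [WithTop.coe_le_coe]
    have : (0 : ℚ) ≤ (Nat.find h0 : ℚ) / (N * r.den : ℕ) := by positivity
    linarith
  -- If all Taylor coefficients vanish, the function is zero and its order is ∞.
  · push Not at h0
    refine ⟨⊤, le_top, Or.inl ⟨?_, rfl⟩⟩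
    ext z
    have h1 := hs (qpow (1 / (N * r.den : ℕ)) z) (by simpa using qpow_inv_mem_ball H1.1 z)
    simp only [h0, zero_mul] at h1
    have h2 := H1.2.2 z
    simp only at h2
    rw [h2, h1.unique hasSum_zero, mul_zero]; rfl

end Expansions

/-! ### Orders of η and of Klein forms at infinity -/

section EtaKleinExpansions

open Metric Complex Real

lemma unitOrder_eta : UnitOrder (fun z : ℍ => ModularForm.eta z) (1 / 24) := by
  have he : ∀ n : ℕ, n < n + 1 := fun n => n.lt_succ_self
  refine ⟨1, powProd 1 fun n => n + 1, ⟨one_pos, differentiableOn_powProd he, fun z => ?_⟩,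
    fun w hw => powProd_ne_zero he (by simp) (by simpa using hw)⟩
  beta_reduce
  rw [ModularForm.eta, powProd]
  congr 1
  · rw [qpow, Function.Periodic.qParam]
    congr 1
    push_cast
    ring
  · refine tprod_congr fun n => ?_
    rw [ModularForm.eta_q_eq_pow, one_mul]
    simp [qpow]

lemma kleinForm_add_one (a b : ℝ) (z : ℍ) :
    kleinForm (a + 1) b z = -cexp (-(π * I * b)) * kleinForm a b z := by
  rw [kleinForm, kleinForm]
  have : ((a + 1 : ℝ) : ℂ) * z + b = (a * z + b) + z := by push_cast; ring
  rw [this, kleinTheta_add_tau, ← mul_assoc, ← mul_assoc]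
  congr 1
  rw [mul_neg, neg_mul, ← Complex.exp_add, ← Complex.exp_add]
  congr 2
  push_cast
  ring

lemma kleinForm_add_int (a b : ℝ) (k : ℤ) :
    ∃ c : ℂ, c ≠ 0 ∧ ∀ z, kleinForm (a + k) b z = c * kleinForm a b z := by
  have h0 : -cexp (-(π * I * b)) ≠ 0 := neg_ne_zero.mpr (Complex.exp_ne_zero _)
  induction k using Int.induction_on with
  | zero => exact ⟨1, one_ne_zero, fun z => by simp⟩
  | succ k ih =>
    obtain ⟨c, hc, h⟩ := ih
    refine ⟨-cexp (-(π * I * b)) * c, mul_ne_zero h0 hc, fun z => ?_⟩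
    rw [mul_assoc, ← h, ← kleinForm_add_one]
    push_cast
    rw [add_assoc]
  | pred k ih =>
    obtain ⟨c, hc, h⟩ := ih
    refine ⟨(-cexp (-(π * I * b)))⁻¹ * c, mul_ne_zero (inv_ne_zero h0) hc, fun z => ?_⟩
    rw [mul_assoc, ← h, eq_inv_mul_iff_mul_eq₀ h0, ← kleinForm_add_one]
    congr 1
    push_cast
    ring

/-- In W = q^{1/p} every factor of the product becomes 1 - ω^{±1}W^e. The exponent comes from
e^{πi(s/p - 1)w} at w = (sz + t)/p: the square root of the linear factor contributes the -1. -/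
lemma unitOrder_kleinForm_of_lt {p s : ℕ} (hs : s < p) {t : ℤ} (ht : s = 0 → ¬ (p : ℤ) ∣ t) :
    UnitOrder (kleinForm (s / p) (t / p)) ((s / p : ℚ) * (s / p - 1) / 2) := by
  have hp : 0 < p := by lia
  have hpC : (p : ℂ) ≠ 0 := by exact_mod_cast hp.ne'
  set ω : ℂ := nome (t / p) with hω
  have hω1 : ‖ω‖ = 1 := by
    have := norm_nome_ratCast (t / p)
    push_cast at this
    exact this
  have hω2 : ‖ω⁻¹‖ = 1 := by rw [norm_inv, hω1, inv_one]
  set e₁ : ℕ → ℕ := fun n => p * (n + 1) + s with he₁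
  set e₂ : ℕ → ℕ := fun n => p * (n + 1) - s with he₂
  set e₃ : ℕ → ℕ := fun n => p * (n + 1) with he₃
  have h₁ : ∀ n, n < e₁ n := fun n => by simp only [he₁]; nlinarith
  have h₂ : ∀ n, n < e₂ n := fun n => by
    simp only [he₂]
    have : n ≤ p * n := Nat.le_mul_of_pos_left n hp
    rw [mul_add]; lia
  have h₃ : ∀ n, n < e₃ n := fun n => by simp only [he₃]; nlinarith
  have hd₃ : ∀ w ∈ ball (0 : ℂ) 1, powProd 1 e₃ w ^ 2 ≠ 0 := fun w hw =>
    pow_ne_zero 2 (powProd_ne_zero h₃ (by simp) (by simpa using hw))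
  set c : ℂ := cexp (π * I * ((s / p - 1) * (t / p))) with hc
  refine ⟨p, fun w => c * ((ω * w ^ s - 1) * (powProd ω e₁ w * powProd ω⁻¹ e₂ w) /
    powProd 1 e₃ w ^ 2), ⟨hp, ?_, fun z => ?_⟩, fun w hw => ?_⟩
  · refine DifferentiableOn.const_mul ?_ c
    refine DifferentiableOn.div ?_ ((differentiableOn_powProd h₃).pow 2) hd₃
    exact (by fun_prop : DifferentiableOn ℂ (fun w => ω * w ^ s - 1) _).mul
      ((differentiableOn_powProd h₁).mul (differentiableOn_powProd h₂))
  · set W := qpow (1 / p) z with hW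
    have hW0 : W ≠ 0 := qpow_ne_zero _ _
    have hω0 : ω ≠ 0 := nome_ne_zero _
    have hq : nome z = W ^ p := by
      rw [hW, ← qpow_natCast_mul, ← qpow_one]
      congr 1
      have : (p : ℚ) ≠ 0 := by exact_mod_cast hp.ne'
      field_simp
    set w : ℂ := ((s / p : ℝ) : ℂ) * z + (t / p : ℝ) with hw
    have hx : nome w = ω * W ^ s := by
      rw [hW, ← qpow_natCast_mul, qpow_eq_nome, hω, ← nome_add, hw]
      congr 1
      push_cast
      ring
    have k₁ : qPochhammer (nome w) (nome z) = powProd ω e₁ W := by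
      refine tprod_congr fun n => ?_
      rw [hx, hq]; simp only [he₁]; ring
    have k₂ : qPochhammer (nome w)⁻¹ (nome z) = powProd ω⁻¹ e₂ W := by
      refine tprod_congr fun n => ?_
      have : W ^ (p * (n + 1)) = W ^ e₂ n * W ^ s := by
        rw [← pow_add]; congr 1
        have := h₂ n
        simp only [he₂] at this ⊢; lia
      rw [hx, hq, ← pow_mul, this, mul_inv]
      field_simp
    have k₃ : qPochhammer 1 (nome z) = powProd 1 e₃ W := by
      refine tprod_congr fun n => ?_
      rw [hq, ← pow_mul]
    have k₄ : cexp (π * I * w) - cexp (-(π * I * w)) = cexp (-(π * I * w)) * (nome w - 1) := by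
      rw [mul_sub, mul_one, exp_pi_sq, sq, ← mul_assoc, ← Complex.exp_add, neg_add_cancel,
        Complex.exp_zero, one_mul]
    have k₅ : cexp (π * I * (s / p : ℝ) * w) * cexp (-(π * I * w)) =
        qpow ((s / p : ℚ) * (s / p - 1) / 2) z * c := by
      rw [qpow, hc, ← Complex.exp_add, ← Complex.exp_add, hw]
      congr 1
      push_cast
      field_simp
      ring
    rw [kleinForm, ← hw, kleinTheta, k₁, k₂, k₃, k₄, hx, ← mul_assoc (qpow _ z), ← k₅]
    ring
  · refine mul_ne_zero (Complex.exp_ne_zero _) (div_ne_zero (mul_ne_zero ?_ ?_) (hd₃ w hw))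
    · have hw' : ‖w‖ < 1 := by simpa using hw
      rw [← neg_ne_zero, neg_sub]
      -- For s = 0 the linear factor is the constant ω - 1, nonzero exactly because p ∤ t.
      by_cases h0 : s = 0
      · subst h0
        rw [pow_zero, mul_one, sub_ne_zero]
        intro h1
        obtain ⟨n, hn⟩ := (nome_eq_one_iff _).mp h1.symm
        rw [div_eq_iff hpC] at hn
        exact ht rfl ⟨n, by rw [mul_comm]; exact_mod_cast hn⟩
      · exact one_sub_mul_pow_ne_zero h0 hω1.le hw'
    · exact mul_ne_zero (powProd_ne_zero h₁ hω1.le (by simpa using hw))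
        (powProd_ne_zero h₂ hω2.le (by simpa using hw))

theorem unitOrder_kleinForm {p : ℕ} (hp : 0 < p) {s t : ℤ} {s₀ : ℕ} (hs : s₀ < p)
    (hss : s ≡ s₀ [ZMOD p]) (ht : (p : ℤ) ∣ s → ¬ (p : ℤ) ∣ t) :
    UnitOrder (kleinForm (s / p) (t / p)) ((s₀ / p : ℚ) * (s₀ / p - 1) / 2) := by
  obtain ⟨k, hk⟩ := hss.symm.dvd
  have hs' : (s : ℝ) / p = s₀ / p + k := by
    have : (p : ℝ) ≠ 0 := by positivity
    field_simp
    have : s = s₀ + p * k := by linarith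
    rw [this]; push_cast; ring
  obtain ⟨c, hc, h⟩ := kleinForm_add_int (s₀ / p) (t / p) k
  have h1 := (unitOrder_kleinForm_of_lt hs (t := t) (fun h0 => ht ⟨k, by rw [← hk, h0]; simp⟩)
    ).const_mul hc
  rw [hs', show kleinForm (s₀ / p + k) (t / p) = _ from funext h]
  exact h1

end EtaKleinExpansions

/-! ### Action of SL₂(ℤ) on Klein forms and on η²⁴ -/

section ModularTransformations

open UpperHalfPlane

/-- The factor of automorphy `c z + d`. -/
def autFactor (A : SL(2, ℤ)) (z : ℍ) : ℂ := A 1 0 * z + A 1 1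

lemma denom_eq_autFactor (A : SL(2, ℤ)) (z : ℍ) : denom A z = autFactor A z :=
  ModularGroup.denom_apply A z

lemma autFactor_ne_zero (A : SL(2, ℤ)) (z : ℍ) : autFactor A z ≠ 0 := by
  rw [← denom_eq_autFactor]
  exact denom_ne_zero _ z

lemma det_eq_one (A : SL(2, ℤ)) : A 0 0 * A 1 1 - A 0 1 * A 1 0 = 1 := by
  have := A.det_coe
  rwa [Matrix.det_fin_two] at this

lemma coe_smul_eq (A : SL(2, ℤ)) (z : ℍ) :
    ((A • z : ℍ) : ℂ) = (A 0 0 * z + A 0 1) / autFactor A z := by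
  rw [coe_specialLinearGroup_apply]
  simp [autFactor]

/-- A acts on the row vector (a, b) from the right, so it suffices to treat the generators S and T.
The index is quantified inside because the induction changes it. -/
lemma kleinForm_slash (A : SL(2, ℤ)) : ∀ a b : ℝ, (kleinForm a b) ∣[(-1 : ℤ)] A =
    kleinForm (a * A 0 0 + b * A 1 0) (a * A 0 1 + b * A 1 1) := by
  have hA : A ∈ Subgroup.closure {ModularGroup.S, ModularGroup.T} := by
    simp [SpecialLinearGroup.SL2Z_generators]
  induction hA using Subgroup.closure_induction with
  | mem A hA =>
    intro a b
    rcases hA with rfl | rfl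
    · ext z
      rw [ModularForm.SL_slash_apply, denom_eq_autFactor, kleinForm_S]
      have := z.ne_zero
      simp [ModularGroup.S, autFactor]
      field_simp
    · ext z
      rw [ModularForm.SL_slash_apply, denom_eq_autFactor, kleinForm_T]
      simp [ModularGroup.T, autFactor]
  | one => intro a b; simp
  | mul A B _ _ hA hB =>
    intro a b
    rw [SlashAction.slash_mul, hA, hB]
    congr 1 <;>
    · simp only [Matrix.SpecialLinearGroup.coe_mul, Matrix.mul_apply, Fin.sum_univ_two]
      push_cast
      ring
  | inv A _ hA =>
    intro a b
    have h := hA (a * A⁻¹ 0 0 + b * A⁻¹ 1 0) (a * A⁻¹ 0 1 + b * A⁻¹ 1 1)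
    have hd : (A 0 0 * A 1 1 - A 0 1 * A 1 0 : ℝ) = 1 := by exact_mod_cast det_eq_one A
    have e1 : (a * A⁻¹ 0 0 + b * A⁻¹ 1 0) * A 0 0 + (a * A⁻¹ 0 1 + b * A⁻¹ 1 1) * A 1 0 = a := by
      simp [Matrix.SpecialLinearGroup.SL2_inv_expl]
      linear_combination a * hd
    have e2 : (a * A⁻¹ 0 0 + b * A⁻¹ 1 0) * A 0 1 + (a * A⁻¹ 0 1 + b * A⁻¹ 1 1) * A 1 1 = b := by
      simp [Matrix.SpecialLinearGroup.SL2_inv_expl]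
      linear_combination b * hd
    rw [e1, e2] at h
    rw [← h, ← SlashAction.slash_mul, mul_inv_cancel, SlashAction.slash_one]

lemma kleinForm_smul (A : SL(2, ℤ)) (a b : ℝ) (z : ℍ) :
    kleinForm a b (A • z) = (autFactor A z)⁻¹ *
      kleinForm (a * A 0 0 + b * A 1 0) (a * A 0 1 + b * A 1 1) z := by
  rw [← kleinForm_slash, ModularForm.SL_slash_apply, denom_eq_autFactor]
  have := autFactor_ne_zero A z
  simp
  field_simp

lemma eta_pow_smul (A : SL(2, ℤ)) (z : ℍ) :
    ModularForm.eta (A • z : ℍ) ^ 24 = autFactor A z ^ 12 * ModularForm.eta z ^ 24 := by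
  have h := congrFun (SlashInvariantForm.slash_action_generators_SL2Z
    ModularForm.discriminant_S_invariant ModularForm.discriminant_T_invariant A) z
  rw [ModularForm.SL_slash_apply, denom_eq_autFactor] at h
  simp only [ModularForm.discriminant] at h
  have := autFactor_ne_zero A z
  rw [← h]
  simp only [zpow_neg, zpow_ofNat]
  field_simp

end ModularTransformations

/-! ### Moving affine maps of determinant p past SL₂(ℤ) -/

section HeckeDecomposition

open UpperHalfPlane

/-- Hermite normal form in prime determinant: gcd(x, y) divides p. If it is p, the column is divided
by p; if it is 1, the column is completed to a unimodular matrix by Bézout. -/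
lemma exists_factorization {p : ℕ} (hp : p.Prime) {x y u v : ℤ} (hdet : x * v - u * y = p) :
    ∃ (A : SL(2, ℤ)) (a d : ℕ) (b : ℤ), a * d = p ∧ (d = 1 ↔ (p : ℤ) ∣ x ∧ (p : ℤ) ∣ y) ∧
      x = A 0 0 * a ∧ y = A 1 0 * a ∧ u = A 0 0 * b + A 0 1 * d ∧ v = A 1 0 * b + A 1 1 * d := by
  have hp0 : (p : ℤ) ≠ 0 := by exact_mod_cast hp.ne_zero
  by_cases h : (p : ℤ) ∣ x ∧ (p : ℤ) ∣ y
  · obtain ⟨⟨x', rfl⟩, ⟨y', rfl⟩⟩ := h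
    have hd : x' * v - u * y' = 1 := mul_left_cancel₀ hp0 (by linear_combination hdet)
    exact ⟨⟨!![x', u; y', v], by rw [Matrix.det_fin_two_of, hd]⟩, p, 1, 0, by simp, by simp,
      by simp [mul_comm], by simp [mul_comm], by simp, by simp⟩
  · have hcop : IsCoprime x y := by
      rw [Int.isCoprime_iff_gcd_eq_one]
      have hg : x.gcd y ∣ p := by
        have : (x.gcd y : ℤ) ∣ p := by
          rw [← hdet]
          exact dvd_sub ((Int.gcd_dvd_left ..).mul_right _) ((Int.gcd_dvd_right ..).mul_left _)
        exact_mod_cast this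
      rcases (Nat.dvd_prime hp).mp hg with h1 | h1
      · exact h1
      · exact absurd ⟨h1 ▸ Int.gcd_dvd_left .., h1 ▸ Int.gcd_dvd_right ..⟩ h
    obtain ⟨s, t, hst⟩ := hcop
    refine ⟨⟨!![x, -t; y, s], by rw [Matrix.det_fin_two_of]; linear_combination hst⟩, 1, p,
      s * u + t * v, by simp, ?_, by simp, by simp, ?_, ?_⟩
    · simp [hp.ne_one, h]
    · simp only [Matrix.of_apply, Matrix.cons_val]
      rw [← hdet]
      linear_combination -u * hst
    · simp only [Matrix.of_apply, Matrix.cons_val]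
      rw [← hdet]
      linear_combination -v * hst

/-- Commuting an affine map of prime determinant past an element of `SL₂(ℤ)`. -/
lemma exists_affineMap_smul {p : ℕ} (hp : p.Prime) {a₀ d₀ : ℕ} (ha₀ : 0 < a₀) (hd₀ : 0 < d₀)
    (had : a₀ * d₀ = p) (b₀ : ℤ) (A : SL(2, ℤ)) :
    ∃ (A' : SL(2, ℤ)) (a d : ℕ) (b : ℤ) (ha : 0 < a) (hd : 0 < d), a * d = p ∧
      (d = 1 ↔ (p : ℤ) ∣ a₀ * A 0 0 + b₀ * A 1 0 ∧ (p : ℤ) ∣ d₀ * A 1 0) ∧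
      d₀ * A 1 0 = A' 1 0 * a ∧
      (∀ z, affineMap ha₀ hd₀ b₀ (A • z) = A' • affineMap ha hd b z) ∧
      ∀ z, autFactor A' (affineMap ha hd b z) = (d₀ / d : ℂ) * autFactor A z := by
  have hdet : (a₀ * A 0 0 + b₀ * A 1 0) * (d₀ * A 1 1) - (a₀ * A 0 1 + b₀ * A 1 1) * (d₀ * A 1 0) =
      (p : ℤ) := by
    rw [← had]
    push_cast
    linear_combination a₀ * d₀ * det_eq_one A
  obtain ⟨A', a, d, b, h, hiff, e1, e2, e3, e4⟩ := exists_factorization hp hdet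
  have hpos := hp.pos
  rw [← h] at hpos
  have ha : 0 < a := Nat.pos_of_mul_pos_right hpos
  have hd : 0 < d := Nat.pos_of_mul_pos_left hpos
  have hdC : (d : ℂ) ≠ 0 := by exact_mod_cast hd.ne'
  have hd₀C : (d₀ : ℂ) ≠ 0 := by exact_mod_cast hd₀.ne'
  have e1' : (a₀ * A 0 0 + b₀ * A 1 0 : ℂ) = A' 0 0 * a := by exact_mod_cast e1
  have e2' : (d₀ * A 1 0 : ℂ) = A' 1 0 * a := by exact_mod_cast e2
  have e3' : (a₀ * A 0 1 + b₀ * A 1 1 : ℂ) = A' 0 0 * b + A' 0 1 * d := by exact_mod_cast e3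
  have e4' : (d₀ * A 1 1 : ℂ) = A' 1 0 * b + A' 1 1 * d := by exact_mod_cast e4
  have haut : ∀ z, autFactor A' (affineMap ha hd b z) = (d₀ / d : ℂ) * autFactor A z := by
    intro z
    rw [autFactor, autFactor, coe_affineMap]
    field_simp
    linear_combination -(z : ℂ) * e2' - e4'
  refine ⟨A', a, d, b, ha, hd, h, hiff, e2, fun z => ?_, haut⟩
  apply UpperHalfPlane.ext
  have hj := autFactor_ne_zero A z
  rw [coe_affineMap, coe_smul_eq, coe_smul_eq, haut, coe_affineMap]
  field_simp
  rw [autFactor]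
  linear_combination (z : ℂ) * e1' + e3'

/-- The values lie in a finite set of roots, and the half-plane is connected. -/
lemma exists_const_of_pow_eq {f : ℍ → ℂ} (hf : Continuous f) {n : ℕ} (hn : n ≠ 0) {C : ℂ}
    (hC : C ≠ 0) (h : ∀ z, f z ^ n = C) : ∃ c : ℂ, c ≠ 0 ∧ ∀ z, f z = c := by
  have hfin : {x : ℂ | x ^ n = C}.Finite := by
    refine (Polynomial.nthRootsFinset n C).finite_toSet.subset fun x hx => ?_
    simpa [Polynomial.mem_nthRootsFinset (Nat.pos_of_ne_zero hn)] using hx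
  have hsub := hfin.countable.isTotallyDisconnected _
    (Set.range_subset_iff.mpr h : Set.range f ⊆ _) (isPreconnected_range hf)
  refine ⟨f I, fun h0 => hC ?_, fun z => hsub ⟨z, rfl⟩ ⟨I, rfl⟩⟩
  rw [← h I, h0, zero_pow hn]

lemma continuous_eta : Continuous fun z : ℍ => ModularForm.eta z := by
  rw [continuous_iff_continuousAt]
  intro z
  exact (ModularForm.differentiableAt_eta_of_mem_upperHalfPlaneSet z.2).continuousAt.comp
    UpperHalfPlane.continuous_coe.continuousAt

lemma continuous_affineMap {a d : ℕ} (ha : 0 < a) (hd : 0 < d) (b : ℤ) :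
    Continuous (affineMap ha hd b) := by
  rw [UpperHalfPlane.isEmbedding_coe.continuous_iff]
  have : ((↑) : ℍ → ℂ) ∘ affineMap ha hd b = fun z : ℍ => ((a * z + b) / d : ℂ) := rfl
  rw [this]
  have := UpperHalfPlane.continuous_coe
  fun_prop

lemma continuous_SL_smul (A : SL(2, ℤ)) : Continuous fun z : ℍ => A • z := by
  rw [UpperHalfPlane.isEmbedding_coe.continuous_iff]
  have : ((↑) : ℍ → ℂ) ∘ (fun z : ℍ => A • z) =
      fun z : ℍ => (A 0 0 * z + A 0 1 : ℂ) / autFactor A z := by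
    ext z; exact coe_smul_eq A z
  rw [this]
  have := UpperHalfPlane.continuous_coe
  exact Continuous.div (by fun_prop) (by unfold autFactor; fun_prop) (autFactor_ne_zero A)

lemma eta_ne_zero' (z : ℍ) : ModularForm.eta z ≠ 0 := ModularForm.eta_ne_zero z.2

/-- The value of `η` along an affine map, transported by `A`, relative to the value at the
upper triangular part. -/
lemma eta_affineMap_pow {a₀ d₀ a d : ℕ} {ha₀ : 0 < a₀} {hd₀ : 0 < d₀} {b₀ b : ℤ} {ha : 0 < a}
    {hd : 0 < d} {A A' : SL(2, ℤ)}
    (h : ∀ z, affineMap ha₀ hd₀ b₀ (A • z) = A' • affineMap ha hd b z)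
    (hj : ∀ z, autFactor A' (affineMap ha hd b z) = (d₀ / d : ℂ) * autFactor A z) (z : ℍ) :
    (ModularForm.eta (affineMap ha₀ hd₀ b₀ (A • z)) / ModularForm.eta (affineMap ha hd b z)) ^ 24 =
      (d₀ / d : ℂ) ^ 12 * autFactor A z ^ 12 := by
  rw [div_pow, h, eta_pow_smul, hj, mul_div_assoc,
    div_self (pow_ne_zero 24 (eta_ne_zero' _)), mul_one, mul_pow]

/-- In a quotient of two η values the automorphy factors cancel, so the transformed quotient over
the untransformed one has constant 24th power. -/
lemma exists_eta_ratio {a₁ d₁ a₁' d₁' : ℕ} {ha₁ : 0 < a₁} {hd₁ : 0 < d₁} {b₁ b₁' : ℤ}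
    {ha₁' : 0 < a₁'} {hd₁' : 0 < d₁'} {a₂ d₂ a₂' d₂' : ℕ} {ha₂ : 0 < a₂} {hd₂ : 0 < d₂}
    {b₂ b₂' : ℤ} {ha₂' : 0 < a₂'} {hd₂' : 0 < d₂'} {A A₁ A₂ : SL(2, ℤ)}
    (h₁ : ∀ z, affineMap ha₁ hd₁ b₁ (A • z) = A₁ • affineMap ha₁' hd₁' b₁' z)
    (hj₁ : ∀ z, autFactor A₁ (affineMap ha₁' hd₁' b₁' z) = (d₁ / d₁' : ℂ) * autFactor A z)
    (h₂ : ∀ z, affineMap ha₂ hd₂ b₂ (A • z) = A₂ • affineMap ha₂' hd₂' b₂' z)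
    (hj₂ : ∀ z, autFactor A₂ (affineMap ha₂' hd₂' b₂' z) = (d₂ / d₂' : ℂ) * autFactor A z) :
    ∃ c : ℂ, c ≠ 0 ∧ ∀ z,
      ModularForm.eta (affineMap ha₁ hd₁ b₁ (A • z)) *
        (ModularForm.eta (affineMap ha₂ hd₂ b₂ (A • z)))⁻¹ =
      c * (ModularForm.eta (affineMap ha₁' hd₁' b₁' z) *
        (ModularForm.eta (affineMap ha₂' hd₂' b₂' z))⁻¹) := by
  have hc₁ : Continuous fun z : ℍ => ModularForm.eta (affineMap ha₁ hd₁ b₁ (A • z)) :=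
    continuous_eta.comp ((continuous_affineMap _ _ _).comp (continuous_SL_smul A))
  have hc₂ : Continuous fun z : ℍ => ModularForm.eta (affineMap ha₂ hd₂ b₂ (A • z)) :=
    continuous_eta.comp ((continuous_affineMap _ _ _).comp (continuous_SL_smul A))
  have hc₁' : Continuous fun z : ℍ => ModularForm.eta (affineMap ha₁' hd₁' b₁' z) :=
    continuous_eta.comp (continuous_affineMap _ _ _)
  have hc₂' : Continuous fun z : ℍ => ModularForm.eta (affineMap ha₂' hd₂' b₂' z) :=
    continuous_eta.comp (continuous_affineMap _ _ _)
  have hne : ∀ {a d : ℕ}, 0 < a → 0 < d → (a / d : ℂ) ^ 12 ≠ 0 := fun ha hd =>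
    pow_ne_zero _ (div_ne_zero (by exact_mod_cast ha.ne') (by exact_mod_cast hd.ne'))
  obtain ⟨c, hc, h⟩ := exists_const_of_pow_eq
    ((hc₁.div hc₁' fun z => eta_ne_zero' _).div (hc₂.div hc₂' fun z => eta_ne_zero' _)
      fun z => div_ne_zero (eta_ne_zero' _) (eta_ne_zero' _)) (n := 24) (by norm_num)
    (C := (d₁ / d₁' : ℂ) ^ 12 / (d₂ / d₂' : ℂ) ^ 12) (div_ne_zero (hne hd₁ hd₁') (hne hd₂ hd₂'))
    (fun z => by
      have := autFactor_ne_zero A z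
      simp only [Pi.div_apply]
      rw [div_pow, eta_affineMap_pow h₁ hj₁, eta_affineMap_pow h₂ hj₂,
        mul_div_mul_right _ _ (pow_ne_zero 12 this)])
  refine ⟨c, hc, fun z => ?_⟩
  rw [← h z]
  simp only [Pi.div_apply]
  have n1 := eta_ne_zero' (affineMap ha₁' hd₁' b₁' z)
  have n2 := eta_ne_zero' (affineMap ha₂' hd₂' b₂' z)
  have n3 := eta_ne_zero' (affineMap ha₂ hd₂ b₂ (A • z))
  field_simp

end HeckeDecomposition

/-! ### The p-dissection as a sum of modular terms -/

section Dissection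

open Finset Complex Real

lemma zeta_eq_nome (p : ℕ) : zeta p = nome (1 / p) := by
  rw [zeta, nome, mul_one_div]

lemma zeta_pow {p : ℕ} (hp : 0 < p) : zeta p ^ p = 1 := by
  have : (p : ℂ) ≠ 0 := by exact_mod_cast hp.ne'
  rw [zeta_eq_nome, ← nome_nat_mul, mul_one_div, div_self this, nome_one]

lemma sum_nome_div {p : ℕ} (hp : 0 < p) (n : ℤ) :
    ∑ k ∈ range p, nome ((k : ℂ) * (n / p)) = if (p : ℤ) ∣ n then (p : ℂ) else 0 := by
  have hpC : (p : ℂ) ≠ 0 := by exact_mod_cast hp.ne'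
  simp_rw [nome_nat_mul]
  split_ifs with h
  · obtain ⟨m, rfl⟩ := h
    have : nome (((p * m : ℤ) : ℂ) / p) = 1 := by
      push_cast
      rw [mul_div_cancel_left₀ _ hpC, nome_int]
    rw [this]
    simp
  · have h1 : nome ((n : ℂ) / p) ≠ 1 := by
      rw [Ne, nome_eq_one_iff]
      rintro ⟨m, hm⟩
      rw [div_eq_iff hpC] at hm
      exact h ⟨m, by rw [mul_comm]; exact_mod_cast hm⟩
    rw [geom_sum_eq h1, ← nome_nat_mul, mul_div_cancel₀ _ hpC, nome_int, sub_self, zero_div]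

lemma nome_affineMap {p : ℕ} (hp : 0 < p) (k : ℕ) (z : ℍ) :
    nome (affineMap one_pos hp k z) = nome (k / p) * qpow (1 / p) z := by
  have := qpow_affineMap one_pos hp k 1 z
  rw [qpow_one] at this
  simpa using this

/-- Extracting an arithmetic progression of exponents by a root of unity filter. -/
lemma hasSum_dissection {p m s : ℕ} (hp : 0 < p) (hm : m < p) (c : ℕ → ℂ) (H : ℕ → ℂ) (z : ℍ)
    (hH : ∀ k ∈ range p, HasSum (fun N => c N * nome (affineMap one_pos hp k z) ^ N) (H k)) :
    HasSum (fun n : ℕ => qpow (m / p) z *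
        if s ≤ p * n + m then c (p * n + m - s) * qpow n z else 0)
      ((p : ℂ)⁻¹ * ∑ k ∈ range p, nome ((k : ℂ) * ((s - m) / p)) * qpow (s / p) z * H k) := by
  have hpC : (p : ℂ) ≠ 0 := by exact_mod_cast hp.ne'
  -- G is indexed by the shifted exponent j = N + s; the filter keeps j ≡ m mod p, and the sum is
  -- then reindexed by j = pn + m.
  set G : ℕ → ℂ := fun j => if s ≤ j ∧ (p : ℤ) ∣ (j : ℤ) - m then c (j - s) * qpow (j / p) z else 0
    with hG
  have h1 := (hasSum_sum fun k hk => (hH k hk).mul_left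
    (nome ((k : ℂ) * ((s - m) / p)) * qpow (s / p) z)).mul_left (p : ℂ)⁻¹
  have h2 : HasSum (fun N => G (N + s))
      ((p : ℂ)⁻¹ * ∑ k ∈ range p, nome ((k : ℂ) * ((s - m) / p)) * qpow (s / p) z * H k) := by
    convert! h1 using 2 with N
    have e : ∀ k ∈ range p, nome ((k : ℂ) * ((s - m) / p)) * qpow (s / p) z *
        (c N * nome (affineMap one_pos hp k z) ^ N) =
        c N * qpow ((N + s : ℕ) / p) z * nome ((k : ℂ) * (((N + s : ℕ) - m : ℤ) / p)) := by
      intro k _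
      rw [nome_affineMap, mul_pow, ← nome_nat_mul, ← qpow_natCast_mul]
      have e1 : (((N + s : ℕ) : ℚ) / p) = s / p + N * (1 / p) := by push_cast; ring
      have e2 : (k : ℂ) * (((N + s : ℕ) - m : ℤ) / p) =
          (k : ℂ) * ((s - m) / p) + N * (k / p) := by push_cast; ring
      rw [e1, e2, qpow_add, nome_add]
      ring
    rw [sum_congr rfl e, ← mul_sum, sum_nome_div hp]
    simp only [hG]
    by_cases hd : (p : ℤ) ∣ ((N + s : ℕ) : ℤ) - m
    · rw [if_pos ⟨Nat.le_add_left _ _, hd⟩, if_pos hd, Nat.add_sub_cancel]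
      field_simp
    · rw [if_neg (fun h => hd h.2), if_neg hd]; simp
  have h3 := (hasSum_nat_add_iff s).mp h2
  rw [sum_eq_zero (fun i hi => if_neg fun h => by have := mem_range.mp hi; lia), add_zero] at h3
  have hinj : Function.Injective fun n : ℕ => p * n + m := fun a b hab =>
    Nat.eq_of_mul_eq_mul_left hp (Nat.add_right_cancel hab)
  have h4 := (hinj.hasSum_iff (f := G) (fun j hj => ?_)).mpr h3
  · convert! h4 using 2 with n
    simp only [hG, Function.comp]
    have hd : (p : ℤ) ∣ ((p * n + m : ℕ) : ℤ) - m := ⟨n, by push_cast; ring⟩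
    by_cases hs : s ≤ p * n + m
    · rw [if_pos hs, if_pos ⟨hs, hd⟩]
      have : ((p * n + m : ℕ) : ℚ) / p = m / p + n := by
        have : (p : ℚ) ≠ 0 := by exact_mod_cast hp.ne'
        push_cast; field_simp; ring
      rw [this, qpow_add]; ring
    · rw [if_neg hs, if_neg (fun h => hs h.1), mul_zero]
  · refine if_neg fun h => hj ?_
    obtain ⟨n, hn⟩ := h.2
    -- Since m < p, a natural number j = pn + m forces n ≥ 0.
    have hn0 : 0 ≤ n := by
      by_contra hneg
      have : n ≤ -1 := by lia
      have : (p : ℤ) * n ≤ p * (-1) := mul_le_mul_of_nonneg_left this (by lia)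
      lia
    refine ⟨n.toNat, ?_⟩
    have : ((n.toNat : ℕ) : ℤ) = n := Int.toNat_of_nonneg hn0
    zify
    rw [this]; lia

lemma eta_eq_qpow_mul (z : ℍ) : ModularForm.eta z = qpow (1 / 24) z * qPochhammer 1 (nome z) := by
  rw [ModularForm.eta]
  congr 1
  · rw [qpow, Function.Periodic.qParam]
    congr 1
    push_cast
    ring
  · refine tprod_congr fun n => ?_
    rw [ModularForm.eta_q_eq_pow, one_mul]; rfl

/-- The half-integral power difference `ζ_p^{1/2} - ζ_p^{-1/2}`. -/
def sqrtZetaDiff (p : ℕ) : ℂ := cexp (π * I * (1 / p : ℂ)) - cexp (-(π * I * (1 / p : ℂ)))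

lemma sqrtZetaDiff_ne_zero {p : ℕ} (hp : 1 < p) : sqrtZetaDiff p ≠ 0 := by
  intro h
  have h1 : nome (1 / p) = 1 := by
    rw [exp_pi_sq, sq]
    nth_rewrite 2 [sub_eq_zero.mp h]
    rw [← Complex.exp_add, add_neg_cancel, Complex.exp_zero]
  obtain ⟨n, hn⟩ := (nome_eq_one_iff _).mp h1
  have hpC : (p : ℂ) ≠ 0 := by exact_mod_cast (by lia : p ≠ 0)
  rw [div_eq_iff hpC] at hn
  have h2 : (1 : ℤ) = n * p := by exact_mod_cast hn
  have h3 : (p : ℤ) ∣ 1 := ⟨n, by rw [h2, mul_comm]⟩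
  have := Int.le_of_dvd one_pos h3
  lia

lemma kleinForm_zero_one_div (p : ℕ) (z : ℍ) : kleinForm 0 (1 / p) z =
    sqrtZetaDiff p * (qPochhammer (zeta p) (nome z) * qPochhammer (zeta p)⁻¹ (nome z)) /
      qPochhammer 1 (nome z) ^ 2 := by
  rw [kleinForm, kleinTheta, sqrtZetaDiff, zeta_eq_nome]
  simp

/-- The modular building blocks of the dissected crank generating function. -/
def crankTerm {p : ℕ} (hp : 0 < p) (k : ℕ) (z : ℍ) : ℂ :=
  ModularForm.eta (affineMap hp one_pos 0 z) *
    (ModularForm.eta (affineMap one_pos hp k z))⁻¹ *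
      (kleinForm 0 (1 / p) (affineMap one_pos hp k z))⁻¹

lemma zeta_norm {p : ℕ} (hp : 0 < p) : ‖zeta p‖ = 1 :=
  Complex.norm_eq_one_of_pow_eq_one (zeta_pow hp) hp.ne'

/-- A prime above 3 is coprime to 24, so p² ≡ 1 mod 24 and the truncated division in `sp` is exact.
-/
lemma sp_eq {p : ℕ} (hp : p.Prime) (hp3 : 3 < p) : (sp p : ℚ) + 1 / 24 = (p : ℚ) ^ 2 / 24 := by
  have h2 : ¬ 2 ∣ p := fun h => by have := (Nat.prime_dvd_prime_iff_eq Nat.prime_two hp).mp h; lia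
  have h3 : ¬ 3 ∣ p := fun h => by
    have := (Nat.prime_dvd_prime_iff_eq Nat.prime_three hp).mp h; lia
  have h24 : p ^ 2 % 24 = 1 := by
    have hlt : p % 24 < 24 := Nat.mod_lt _ (by norm_num)
    have e2 : p % 24 % 2 ≠ 0 := by lia
    have e3 : p % 24 % 3 ≠ 0 := by lia
    rw [Nat.pow_mod]
    interval_cases p % 24 <;> simp_all
  have h : sp p * 24 + 1 = p ^ 2 := by rw [sp]; lia
  have : (sp p : ℚ) * 24 + 1 = (p : ℚ) ^ 2 := by exact_mod_cast h
  linarith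

/-- The filter is applied to the product formula at (z + k)/p. Non-vanishing of the constants is
needed later, so that the exceptional term really occurs. -/
theorem K_eq_sum_crankTerm {p m : ℕ} (hp : p.Prime) (hp3 : 3 < p) (hm : m ≤ p - 1) :
    ∃ c : ℕ → ℂ, (∀ k, c k ≠ 0) ∧
      ∀ z, K p m 1 z = ∑ k ∈ range p, c k * crankTerm hp.pos k z := by
  have hpC : (p : ℂ) ≠ 0 := by exact_mod_cast hp.ne_zero
  refine ⟨fun k => (p : ℂ)⁻¹ * nome ((k : ℂ) * ((sp p - m) / p)) * nome (k * (1 / 24) / p) *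
    sqrtZetaDiff p, fun k => ?_, fun z => ?_⟩
  · exact mul_ne_zero (mul_ne_zero (mul_ne_zero (inv_ne_zero hpC) (nome_ne_zero _))
      (nome_ne_zero _)) (sqrtZetaDiff_ne_zero hp.one_lt)
  have he : ∀ n : ℕ, n < n + 1 := fun n => n.lt_succ_self
  have hH := fun k (_ : k ∈ range p) => hasSum_crankCoeff hp.pos (zeta_pow hp.pos)
    (norm_nome_lt_one (affineMap one_pos hp.pos k z))
  have h := hasSum_dissection (s := sp p) hp.pos (by have := hp.pos; lia : m < p) _ _ z hH
  have hE : ∏' n : ℕ, (1 - qpow (p * (n + 1)) z) =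
      qPochhammer 1 (nome (affineMap hp.pos one_pos 0 z)) := by
    refine tprod_congr fun n => ?_
    rw [← qpow_one, qpow_affineMap]
    beta_reduce
    rw [mul_pow, ← qpow_natCast_mul]
    have e : ((n + 1 : ℕ) : ℚ) * (1 * p / (1 : ℕ)) = p * (n + 1) := by push_cast; ring
    rw [e]
    simp [nome_zero]
  have hK : K p m 1 z = qPochhammer 1 (nome (affineMap hp.pos one_pos 0 z)) * (∑' n : ℕ,
      qpow (m / p) z * if sp p ≤ p * n + m then
        crankCoeff p (zeta p) (p * n + m - sp p) * qpow n z else 0) := by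
    rw [K, hE, tsum_mul_left]
    simp only [crankCoeff, mul_one]
    ring
  rw [hK, h.tsum_eq, mul_left_comm, mul_sum, mul_sum]
  refine sum_congr rfl fun k _ => ?_
  have hη := eta_eq_qpow_mul (affineMap hp.pos one_pos 0 z)
  have hη' := eta_eq_qpow_mul (affineMap one_pos hp.pos k z)
  rw [crankTerm, hη, hη', kleinForm_zero_one_div]
  set y := affineMap one_pos hp.pos k z with hy
  have n1 : qPochhammer 1 (nome y) ≠ 0 := qPochhammer_one_ne_zero y
  have hz1 := zeta_norm hp.pos
  have n2 : qPochhammer (zeta p) (nome y) ≠ 0 :=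
    powProd_ne_zero he hz1.le (norm_nome_lt_one y)
  have n3 : qPochhammer (zeta p)⁻¹ (nome y) ≠ 0 :=
    powProd_ne_zero he (by rw [norm_inv, hz1, inv_one]) (norm_nome_lt_one y)
  have n4 := sqrtZetaDiff_ne_zero hp.one_lt
  have n5 := qpow_ne_zero (1 / 24) y
  have e1 : qpow (1 / 24) (affineMap hp.pos one_pos 0 z) = qpow (p / 24) z := by
    rw [qpow_affineMap]
    simp [nome_zero]
    congr 1; ring
  have e2 : qpow (1 / 24) y = nome (k * (1 / 24) / p) * qpow (1 / (24 * p)) z := by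
    rw [hy, qpow_affineMap]
    congr 2
    · push_cast; ring
    · push_cast; ring
  -- This identity is what the shift by s_p is made for: s_p/p = p/24 - 1/(24p) is the leading
  -- exponent of η(pz)/η(z/p).
  have e3 : qpow (p / 24) z = qpow (sp p / p) z * qpow (1 / (24 * p)) z := by
    rw [← qpow_add]
    congr 1
    have := sp_eq hp hp3
    have : (p : ℚ) ≠ 0 := by exact_mod_cast hp.ne_zero
    field_simp
    linarith
  have n6 := nome_ne_zero (k * (1 / 24) / p)
  have n7 := qpow_ne_zero (1 / (24 * p)) z
  rw [e1, e3, e2]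
  beta_reduce
  simp only [qPochhammer] at n1 n2 n3 ⊢
  generalize nome (k * (1 / 24) / p) = a at n6 ⊢
  generalize qpow (1 / (24 * p)) z = b at n7 ⊢
  generalize nome ((k : ℂ) * ((sp p - m) / p)) = d
  generalize powProd (zeta p)⁻¹ (fun n => n + 1) (nome y) = P at n3 ⊢
  field_simp

end Dissection

/-! ### Order of each term at each cusp -/

section TermOrders

open UpperHalfPlane

lemma slash_one_apply (f : ℍ → ℂ) (A : SL(2, ℤ)) (z : ℍ) :
    (f ∣[(1 : ℤ)] A) z = f (A • z) * (autFactor A z)⁻¹ := by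
  rw [ModularForm.SL_slash_apply, denom_eq_autFactor, zpow_neg_one]

lemma not_dvd_bottom_row {p : ℕ} (hp : p.Prime) (A : SL(2, ℤ)) (h : (p : ℤ) ∣ A 1 0) :
    ¬ (p : ℤ) ∣ A 1 1 := by
  intro h'
  have h1 : (p : ℤ) ∣ 1 := by
    rw [← det_eq_one A]
    exact dvd_sub (h'.mul_left _) (h.mul_left _)
  have := Int.le_of_dvd one_pos h1
  have := hp.two_le
  lia

/-- The orders of η(pz), 1/η(y_k) and 1/𝔨(y_k) add up, for y_k = (z + k)/p. The Klein index (0, 1/p)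
becomes 1/p times the bottom row of `A₂`, so only the residue s of its first entry matters. -/
lemma exists_unitOrder_crankTerm {p : ℕ} (hp : p.Prime) (A : SL(2, ℤ)) (k : ℕ) :
    ∃ (A₂ : SL(2, ℤ)) (a₁ d₁ a₂ d₂ : ℕ), a₁ * d₁ = p ∧ a₂ * d₂ = p ∧
      (d₁ = 1 ↔ (p : ℤ) ∣ A 1 0) ∧ (d₂ = 1 ↔ (p : ℤ) ∣ A 0 0 + k * A 1 0) ∧
      p * A 1 0 = A₂ 1 0 * a₂ ∧ ∀ s : ℕ, s < p → A₂ 1 0 ≡ s [ZMOD p] →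
        UnitOrder (fun z => crankTerm hp.pos k (A • z) * (autFactor A z)⁻¹)
          (1 / 24 * a₁ / d₁ - 1 / 24 * a₂ / d₂ - (s / p : ℚ) * (s / p - 1) / 2 * a₂ / d₂) := by
  obtain ⟨A₁, a₁, d₁, b₁, ha₁, hd₁, h₁, i₁, -, m₁, j₁⟩ :=
    exists_affineMap_smul hp hp.pos one_pos (mul_one p) 0 A
  obtain ⟨A₂, a₂, d₂, b₂, ha₂, hd₂, h₂, i₂, e₂, m₂, j₂⟩ :=
    exists_affineMap_smul hp one_pos hp.pos (one_mul p) k A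
  refine ⟨A₂, a₁, d₁, a₂, d₂, h₁, h₂, by simpa using i₁, by simpa using i₂, e₂, fun s hs hss => ?_⟩
  obtain ⟨c, hc, hη⟩ := exists_eta_ratio m₁ j₁ m₂ j₂
  have hpC : (p : ℂ) ≠ 0 := by exact_mod_cast hp.ne_zero
  have hdC : (d₂ : ℂ) ≠ 0 := by exact_mod_cast hd₂.ne'
  have u₁ := (unitOrder_eta.comp_affineMap ha₁ hd₁ b₁)
  have u₂ := (unitOrder_eta.comp_affineMap ha₂ hd₂ b₂).inv
  have u₃ := ((unitOrder_kleinForm hp.pos hs hss (not_dvd_bottom_row hp A₂)).comp_affineMap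
    ha₂ hd₂ b₂).inv
  have u := ((u₁.mul u₂).mul u₃).const_mul (mul_ne_zero hc (div_ne_zero hpC hdC))
  convert! u using 1
  · ext z
    rw [crankTerm, hη, m₂, kleinForm_smul, j₂]
    have e1 : (0 * A₂ 0 0 + 1 / p * A₂ 1 0 : ℝ) = A₂ 1 0 / p := by ring
    have e2 : (0 * A₂ 0 1 + 1 / p * A₂ 1 1 : ℝ) = A₂ 1 1 / p := by ring
    rw [e1, e2]
    have := autFactor_ne_zero A z
    generalize kleinForm (A₂ 1 0 / p) (A₂ 1 1 / p) (affineMap ha₂ hd₂ b₂ z) = κ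
    rw [mul_inv, inv_inv]
    field_simp
  · ring

/-- Here η(pz) keeps the scaling p while y_k keeps the scaling 1/p, and s = 0: the order is p/24 -
1/(24p). -/
lemma unitOrder_crankTerm_of_dvd {p : ℕ} (hp : p.Prime) {A : SL(2, ℤ)} (k : ℕ)
    (hA : (p : ℤ) ∣ A 1 0) :
    UnitOrder (fun z => crankTerm hp.pos k (A • z) * (autFactor A z)⁻¹)
      (((p : ℚ) ^ 2 - 1) / (24 * p)) := by
  obtain ⟨A₂, a₁, d₁, a₂, d₂, h₁, h₂, i₁, i₂, e, hu⟩ := exists_unitOrder_crankTerm hp A k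
  have hd₁ := i₁.mpr hA
  have hd₂ : d₂ ≠ 1 := fun h => by
    have h' := (dvd_sub (i₂.mp h) (hA.mul_left (k : ℤ)))
    rw [add_sub_cancel_right] at h'
    have h1 : (p : ℤ) ∣ 1 := by
      rw [← det_eq_one A]
      exact dvd_sub (h'.mul_right _) (hA.mul_left _)
    have := Int.le_of_dvd one_pos h1
    have := hp.two_le
    lia
  have hd₂' : d₂ = p := ((Nat.dvd_prime hp).mp ⟨a₂, by rw [mul_comm, h₂]⟩).resolve_left hd₂
  have ha₂ : a₂ = 1 := Nat.eq_of_mul_eq_mul_right hp.pos (by rw [← hd₂', h₂, one_mul, hd₂'])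
  have ha₁ : a₁ = p := by rw [← h₁, hd₁, mul_one]
  subst ha₂
  have h := hu 0 hp.pos ((Int.modEq_zero_iff_dvd.mpr ⟨A 1 0, by simpa using e.symm⟩))
  convert! h using 1
  have : (p : ℚ) ≠ 0 := by exact_mod_cast hp.ne_zero
  rw [ha₁, hd₁, hd₂']
  push_cast
  field_simp
  ring

/-- Both arguments scale by 1/p and s = 0, so the two η orders cancel. -/
lemma unitOrder_crankTerm_of_not_dvd {p : ℕ} (hp : p.Prime) {A : SL(2, ℤ)} {k : ℕ}
    (hA : ¬ (p : ℤ) ∣ A 1 0) (hk : ¬ (p : ℤ) ∣ A 0 0 + k * A 1 0) :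
    UnitOrder (fun z => crankTerm hp.pos k (A • z) * (autFactor A z)⁻¹) 0 := by
  obtain ⟨A₂, a₁, d₁, a₂, d₂, h₁, h₂, i₁, i₂, e, hu⟩ := exists_unitOrder_crankTerm hp A k
  have hd₁ : d₁ = p := ((Nat.dvd_prime hp).mp ⟨a₁, by rw [mul_comm, h₁]⟩).resolve_left
    (i₁.not.mpr hA)
  have hd₂ : d₂ = p := ((Nat.dvd_prime hp).mp ⟨a₂, by rw [mul_comm, h₂]⟩).resolve_left
    (i₂.not.mpr hk)
  have ha₁ : a₁ = 1 := Nat.eq_of_mul_eq_mul_right hp.pos (by rw [← hd₁, h₁, one_mul, hd₁])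
  have ha₂ : a₂ = 1 := Nat.eq_of_mul_eq_mul_right hp.pos (by rw [← hd₂, h₂, one_mul, hd₂])
  subst ha₂
  have h := hu 0 hp.pos ((Int.modEq_zero_iff_dvd.mpr ⟨A 1 0, by simpa using e.symm⟩))
  convert! h using 1
  rw [ha₁, hd₁, hd₂]
  simp

/-- The order contributed by the exceptional residue class at a cusp with denominator `≡ ±s`. -/
def exceptionalOrder (p s : ℕ) : ℚ :=
  -(1 / (2 * (p : ℚ))) * (((p : ℚ) - 1) * ((p : ℚ) + 1) / 12 + (s : ℚ) * ((s : ℚ) - (p : ℚ)))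

lemma unitOrder_crankTerm_exceptional {p : ℕ} (hp : p.Prime) {A : SL(2, ℤ)} {k s : ℕ} (hs : s < p)
    (hA : ¬ (p : ℤ) ∣ A 1 0) (hss : A 1 0 ≡ s [ZMOD p]) (hk : (p : ℤ) ∣ A 0 0 + k * A 1 0) :
    UnitOrder (fun z => crankTerm hp.pos k (A • z) * (autFactor A z)⁻¹)
      (exceptionalOrder p s) := by
  obtain ⟨A₂, a₁, d₁, a₂, d₂, h₁, h₂, i₁, i₂, e, hu⟩ := exists_unitOrder_crankTerm hp A k
  have hd₁ : d₁ = p := ((Nat.dvd_prime hp).mp ⟨a₁, by rw [mul_comm, h₁]⟩).resolve_left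
    (i₁.not.mpr hA)
  have hd₂ := i₂.mpr hk
  have ha₁ : a₁ = 1 := Nat.eq_of_mul_eq_mul_right hp.pos (by rw [← hd₁, h₁, one_mul, hd₁])
  have ha₂ : a₂ = p := by rw [← h₂, hd₂, mul_one]
  have hpZ : (p : ℤ) ≠ 0 := by exact_mod_cast hp.ne_zero
  -- With scaling a₂ = p the lower-left entry is unchanged, so the Klein form now sees the residue
  -- of the cusp's denominator.
  have hA₂ : A₂ 1 0 = A 1 0 := by
    rw [ha₂, mul_comm (A₂ 1 0)] at e
    exact (mul_left_cancel₀ hpZ e).symm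
  have h := hu s hs (hA₂ ▸ hss)
  convert! h using 1
  have : (p : ℚ) ≠ 0 := by exact_mod_cast hp.ne_zero
  rw [ha₁, hd₁, ha₂, hd₂, exceptionalOrder]
  push_cast
  field_simp
  ring

end TermOrders

/-! ### Order of the sum at each cusp -/

section CuspOrders

open UpperHalfPlane Finset

lemma UnitOrder.orderGE {f : ℍ → ℂ} {r : ℚ} (hf : UnitOrder f r) : OrderGE f r :=
  hf.orderEq.orderGE

variable {p m : ℕ}

theorem orderGE_K_slash_of_dvd (hp : p.Prime) (hp3 : 3 < p) (hm : m ≤ p - 1) {A : SL(2, ℤ)}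
    (hA : (p : ℤ) ∣ A 1 0) : OrderGE (K p m 1 ∣[(1 : ℤ)] A) (((p : ℚ) ^ 2 - 1) / (24 * p)) := by
  obtain ⟨c, hc, hK⟩ := K_eq_sum_crankTerm hp hp3 hm
  have h : (K p m 1 ∣[(1 : ℤ)] A) = fun z => ∑ k ∈ range p,
      c k * (crankTerm hp.pos k (A • z) * (autFactor A z)⁻¹) := by
    ext z
    rw [slash_one_apply, hK, sum_mul]
    exact sum_congr rfl fun k _ => by ring
  rw [h]
  exact OrderGE.sum _ fun k _ => ((unitOrder_crankTerm_of_dvd hp k hA).const_mul (hc k)).orderGE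

/-- The lower-left entry is invertible mod p, so the linear congruence has one solution; this
isolates a single exceptional term. -/
lemma exists_residue (hp : p.Prime) {A : SL(2, ℤ)} (hA : ¬ (p : ℤ) ∣ A 1 0) :
    ∃ k ∈ range p, (p : ℤ) ∣ A 0 0 + k * A 1 0 ∧
      ∀ j ∈ range p, (p : ℤ) ∣ A 0 0 + j * A 1 0 → j = k := by
  have hpp : _root_.Prime (p : ℤ) := Nat.prime_iff_prime_int.mp hp
  have hp0 : (p : ℤ) ≠ 0 := hpp.ne_zero
  obtain ⟨u, v, huv⟩ := (hpp.coprime_iff_not_dvd.mpr hA)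
  obtain ⟨k, hk⟩ := Int.eq_ofNat_of_zero_le (Int.emod_nonneg (-A 0 0 * v) hp0)
  have hkp : k < p := by
    have := Int.emod_lt_of_pos (-A 0 0 * v) (b := p) (by have := hp.pos; lia)
    lia
  have hdiv : (k : ℤ) = -A 0 0 * v - p * (-A 0 0 * v / p) := by
    rw [← hk, Int.emod_def]
  refine ⟨k, mem_range.mpr hkp, ⟨A 0 0 * u - (-A 0 0 * v / p) * A 1 0, ?_⟩, fun j hj hjd => ?_⟩
  · generalize -A 0 0 * v / p = w at hdiv ⊢
    rw [hdiv]
    linear_combination -A 0 0 * huv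
  · have h1 : (p : ℤ) ∣ A 0 0 + k * A 1 0 := by
      refine ⟨A 0 0 * u - (-A 0 0 * v / p) * A 1 0, ?_⟩
      generalize -A 0 0 * v / p = w at hdiv ⊢
      rw [hdiv]
      linear_combination -A 0 0 * huv
    have h2 := dvd_sub hjd h1
    rw [show A 0 0 + (j : ℤ) * A 1 0 - (A 0 0 + k * A 1 0) = (j - k) * A 1 0 by ring] at h2
    obtain ⟨w, hw⟩ := (hpp.dvd_or_dvd h2).resolve_right hA
    have hj' := mem_range.mp hj
    have : w = 0 := by
      have hp1 := hp.pos
      by_contra hw0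
      rcases lt_or_gt_of_ne hw0 with h | h
      · have : (p : ℤ) * w ≤ p * (-1) := mul_le_mul_of_nonneg_left (by lia) (by lia)
        lia
      · have : (p : ℤ) * 1 ≤ p * w := mul_le_mul_of_nonneg_left (by lia) (by lia)
        lia
    rw [this, mul_zero] at hw
    lia

lemma exists_K_slash_eq_add (hp : p.Prime) (hp3 : 3 < p) (hm : m ≤ p - 1) {A : SL(2, ℤ)} {s : ℕ}
    (hs : s < p) (hA : ¬ (p : ℤ) ∣ A 1 0) (hss : A 1 0 ≡ s [ZMOD p]) :
    ∃ f g : ℍ → ℂ, (K p m 1 ∣[(1 : ℤ)] A) = (fun z => f z + g z) ∧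
      UnitOrder f (exceptionalOrder p s) ∧ OrderGE g 0 := by
  classical
  obtain ⟨c, hc, hK⟩ := K_eq_sum_crankTerm hp hp3 hm
  obtain ⟨k, hk, hkd, huniq⟩ := exists_residue hp hA
  refine ⟨fun z => c k * (crankTerm hp.pos k (A • z) * (autFactor A z)⁻¹),
    fun z => ∑ j ∈ (range p).erase k, c j * (crankTerm hp.pos j (A • z) * (autFactor A z)⁻¹),
    ?_, (unitOrder_crankTerm_exceptional hp hs hA hss hkd).const_mul (hc k),
    OrderGE.sum _ fun j hj => ?_⟩
  · ext z
    rw [slash_one_apply, hK, sum_mul]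
    beta_reduce
    rw [add_sum_erase _ (fun j => c j * (crankTerm hp.pos j (A • z) * (autFactor A z)⁻¹)) hk]
    exact sum_congr rfl fun k _ => by ring
  · have hj' := mem_erase.mp hj
    exact ((unitOrder_crankTerm_of_not_dvd hp hA
      fun h => hj'.1 (huniq j hj'.2 h)).const_mul (hc j)).orderGE

theorem orderEq_K_slash (hp : p.Prime) (hp3 : 3 < p) (hm : m ≤ p - 1) {A : SL(2, ℤ)} {s : ℕ}
    (hs : s < p) (hA : ¬ (p : ℤ) ∣ A 1 0) (hss : A 1 0 ≡ s [ZMOD p])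
    (hneg : exceptionalOrder p s < 0) :
    OrderEq (K p m 1 ∣[(1 : ℤ)] A) (exceptionalOrder p s) := by
  obtain ⟨f, g, h, hf, hg⟩ := exists_K_slash_eq_add hp hp3 hm hs hA hss
  rw [h]
  exact hf.orderEq.add hg hneg

theorem orderGE_K_slash (hp : p.Prime) (hp3 : 3 < p) (hm : m ≤ p - 1) {A : SL(2, ℤ)} {s : ℕ}
    (hs : s < p) (hA : ¬ (p : ℤ) ∣ A 1 0) (hss : A 1 0 ≡ s [ZMOD p])
    (hnonneg : 0 ≤ exceptionalOrder p s) :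
    OrderGE (K p m 1 ∣[(1 : ℤ)] A) 0 := by
  obtain ⟨f, g, h, hf, hg⟩ := exists_K_slash_eq_add hp hp3 hm hs hA hss
  rw [h]
  exact (hf.orderGE.mono hnonneg).add hg

end CuspOrders

/-! ### Independence of the matrix, and identification of the cusps -/

section InvariantOrders

open UpperHalfPlane Matrix.SpecialLinearGroup

/-- Such a B is ± a translation, which multiplies each coefficient by a number of modulus 1. Two
matrices sending ∞ to the same cusp differ by such a B, so one of them determines the invariant
order. -/
lemma HasOrderAtInfty.slash_upper {g : ℍ → ℂ} {r : WithTop ℚ} (hg : HasOrderAtInfty g r)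
    {B : SL(2, ℤ)} (hB : B 1 0 = 0) : HasOrderAtInfty (g ∣[(1 : ℤ)] B) r := by
  have hdet : B 0 0 * B 1 1 = 1 := by have := det_eq_one B; rwa [hB, mul_zero, sub_zero] at this
  have hdetC : (B 0 0 : ℂ) * B 1 1 = 1 := by exact_mod_cast hdet
  have h11 : (B 1 1 : ℂ) ≠ 0 := right_ne_zero_of_mul_eq_one hdetC
  have hsq : (B 1 1 : ℂ) * B 1 1 = 1 := by
    have : B 1 1 * B 1 1 = 1 := by
      rcases Int.isUnit_iff.mp (.of_mul_eq_one (B 0 0) (by linear_combination hdet) :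
        IsUnit (B 1 1)) with h | h <;> rw [h] <;> norm_num
    exact_mod_cast this
  have hpt : ∀ z : ℍ, B • z = affineMap one_pos one_pos (B 0 1 * B 1 1) z := by
    intro z
    apply UpperHalfPlane.ext
    rw [coe_smul_eq, coe_affineMap, autFactor, hB]
    simp only [Int.cast_mul, Nat.cast_one, Int.cast_zero, zero_mul, zero_add, one_mul, div_one]
    rw [div_eq_iff h11]
    linear_combination (z : ℂ) * (B 1 1 * hdetC - B 0 0 * hsq) - (B 0 1 : ℂ) * hsq
  have hslash : ∀ z : ℍ, (g ∣[(1 : ℤ)] B) z =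
      (B 1 1 : ℂ)⁻¹ * g (affineMap one_pos one_pos (B 0 1 * B 1 1) z) := by
    intro z
    rw [slash_one_apply, hpt, autFactor, hB]
    push_cast
    rw [zero_mul, zero_add, mul_comm]
  rcases hg with ⟨rfl, hr⟩ | ⟨N, m₀, a, hN, ha, hr, hsum⟩
  · exact Or.inl ⟨by ext z; rw [hslash]; simp, hr⟩
  · set t : ℤ := B 0 1 * B 1 1
    refine Or.inr ⟨N, m₀, fun j => (B 1 1 : ℂ)⁻¹ * (a j *
      nome ((((m₀ : ℚ) + j) / N : ℚ) * t / (1 : ℕ))), hN, ?_, hr, fun z => ?_⟩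
    · exact mul_ne_zero (inv_ne_zero h11) (mul_ne_zero ha (nome_ne_zero _))
    · rw [hslash]
      convert! (hsum (affineMap one_pos one_pos t z)).mul_left (B 1 1 : ℂ)⁻¹ using 2 with j
      rw [qpow_affineMap]
      have : (((m₀ : ℚ) + j) / N * (1 : ℕ) / (1 : ℕ) : ℚ) = ((m₀ : ℚ) + j) / N := by simp
      rw [this]
      ring

lemma bottom_left_of_smul_infty {B : SL(2, ℤ)}
    (hB : mapGL ℚ B • (OnePoint.infty : OnePoint ℚ) = OnePoint.infty) : B 1 0 = 0 := by
  rw [OnePoint.smul_infty_eq_self_iff] at hB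
  simpa using hB

lemma hasInvariantOrder_of_exists {f : ℍ → ℂ} {c : OnePoint ℚ} {r : WithTop ℚ} {A : SL(2, ℤ)}
    (hA : mapGL ℚ A • (OnePoint.infty : OnePoint ℚ) = c)
    (h : HasOrderAtInfty (f ∣[(1 : ℤ)] A) r) : HasInvariantOrder 1 f c r := by
  intro A' hA'
  have h1 : mapGL ℚ (A⁻¹ * A') • (OnePoint.infty : OnePoint ℚ) = OnePoint.infty := by
    rw [map_mul, mul_smul, hA', ← hA, ← mul_smul, ← map_mul, inv_mul_cancel, map_one, one_smul]
  have h3 := h.slash_upper (bottom_left_of_smul_infty h1)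
  rwa [← SlashAction.slash_mul, mul_inv_cancel_left] at h3

lemma exists_hasInvariantOrder {f : ℍ → ℂ} {c : OnePoint ℚ} {r : ℚ}
    (h : ∀ A : SL(2, ℤ), mapGL ℚ A • (OnePoint.infty : OnePoint ℚ) = c →
      OrderGE (f ∣[(1 : ℤ)] A) r) :
    ∃ r' : WithTop ℚ, (r : WithTop ℚ) ≤ r' ∧ HasInvariantOrder 1 f c r' := by
  obtain ⟨A, hA⟩ := OnePoint.exists_mem_SL2 ℤ c
  obtain ⟨r', hr, hr'⟩ := (h A hA).exists_hasOrderAtInfty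
  exact ⟨r', hr, hasInvariantOrder_of_exists hA hr'⟩

lemma cusp_eq {A : SL(2, ℤ)} {x : ℚ}
    (hA : mapGL ℚ A • (OnePoint.infty : OnePoint ℚ) = (x : OnePoint ℚ)) :
    A 1 0 ≠ 0 ∧ (A 0 0 : ℚ) = x * A 1 0 := by
  rw [OnePoint.smul_infty_eq_ite] at hA
  by_cases h : (mapGL ℚ A) 1 0 = 0
  · rw [if_pos h] at hA
    exact absurd hA (OnePoint.infty_ne_coe x)
  · rw [if_neg h] at hA
    have h1 := OnePoint.coe_injective hA
    have h0 : (A 1 0 : ℚ) ≠ 0 := by simpa using h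
    refine ⟨by exact_mod_cast h0, ?_⟩
    rw [← h1]
    simp [h0]

lemma bottom_left_of_cusp_zero {A : SL(2, ℤ)}
    (hA : mapGL ℚ A • (OnePoint.infty : OnePoint ℚ) = ((0 : ℚ) : OnePoint ℚ)) :
    A 1 0 = 1 ∨ A 1 0 = -1 := by
  obtain ⟨-, h⟩ := cusp_eq hA
  have h0 : A 0 0 = 0 := by exact_mod_cast (by simpa using h : (A 0 0 : ℚ) = 0)
  have hd := det_eq_one A
  rw [h0] at hd
  exact Int.isUnit_iff.mp (.of_mul_eq_one (-A 0 1) (by linear_combination hd))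

lemma bottom_left_of_cusp_inv {A : SL(2, ℤ)} {n : ℕ} (hn : n ≠ 0)
    (hA : mapGL ℚ A • (OnePoint.infty : OnePoint ℚ) = ((1 / (n : ℚ) : ℚ) : OnePoint ℚ)) :
    A 1 0 = n ∨ A 1 0 = -n := by
  obtain ⟨-, h⟩ := cusp_eq hA
  have hnQ : (n : ℚ) ≠ 0 := by exact_mod_cast hn
  have h1 : A 1 0 = A 0 0 * n := by
    have : (A 1 0 : ℚ) = A 0 0 * n := by rw [h]; field_simp
    exact_mod_cast this
  have hd := det_eq_one A
  rw [h1] at hd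
  rcases Int.isUnit_iff.mp (.of_mul_eq_one (A 1 1 - A 0 1 * n)
    (by linear_combination hd) : IsUnit (A 0 0)) with h0 | h0
  · exact Or.inl (by rw [h1, h0, one_mul])
  · exact Or.inr (by rw [h1, h0, neg_one_mul])

lemma dvd_bottom_left_of_cusp {p n : ℕ} (hp : p.Prime) (hn : ¬ p ∣ n) {A : SL(2, ℤ)}
    (hA : mapGL ℚ A • (OnePoint.infty : OnePoint ℚ) = (((n : ℚ) / (p : ℚ) : ℚ) : OnePoint ℚ)) :
    (p : ℤ) ∣ A 1 0 := by
  obtain ⟨-, h⟩ := cusp_eq hA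
  have hpQ : (p : ℚ) ≠ 0 := by exact_mod_cast hp.ne_zero
  have h1 : (p : ℤ) * A 0 0 = n * A 1 0 := by
    have : (p : ℚ) * A 0 0 = n * A 1 0 := by rw [h]; field_simp
    exact_mod_cast this
  have hpp : _root_.Prime (p : ℤ) := Nat.prime_iff_prime_int.mp hp
  exact (hpp.dvd_or_dvd ⟨_, h1.symm⟩).resolve_left fun h => hn (by exact_mod_cast h)

lemma exceptionalOrder_sub {p n : ℕ} (hn : n ≤ p) :
    exceptionalOrder p (p - n) = exceptionalOrder p n := by
  rw [exceptionalOrder, exceptionalOrder, Nat.cast_sub hn]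
  ring

/-- The sign of the lower-left entry depends on the choice of A; residues n and p - n give the same
exceptional order by `exceptionalOrder_sub`. -/
theorem exists_hasInvariantOrder_K {p m n : ℕ} (hp : p.Prime) (hp3 : 3 < p) (hm : m ≤ p - 1)
    (hn0 : 0 < n) (hnp : n < p) {c : OnePoint ℚ}
    (hc : ∀ A : SL(2, ℤ), mapGL ℚ A • (OnePoint.infty : OnePoint ℚ) = c →
      A 1 0 = n ∨ A 1 0 = -n) :
    ∃ r : WithTop ℚ, HasInvariantOrder 1 (K p m 1) c r ∧
      (exceptionalOrder p n < 0 → r = (exceptionalOrder p n : ℚ)) ∧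
      (0 ≤ exceptionalOrder p n → 0 ≤ r) := by
  have key : ∀ A : SL(2, ℤ), mapGL ℚ A • (OnePoint.infty : OnePoint ℚ) = c →
      ∃ s : ℕ, s < p ∧ ¬ (p : ℤ) ∣ A 1 0 ∧ A 1 0 ≡ s [ZMOD p] ∧
        exceptionalOrder p s = exceptionalOrder p n := by
    intro A hA
    have hnd : ¬ (p : ℤ) ∣ n := fun h =>
      (Nat.le_of_dvd hn0 (by exact_mod_cast h)).not_gt hnp
    rcases hc A hA with h | h
    · exact ⟨n, hnp, h ▸ hnd, by rw [h], rfl⟩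
    · refine ⟨p - n, by lia, by rwa [h, dvd_neg], ?_, exceptionalOrder_sub hnp.le⟩
      rw [h, Int.modEq_iff_dvd, Nat.cast_sub hnp.le]
      exact ⟨1, by ring⟩
  rcases lt_or_ge (exceptionalOrder p n) 0 with hneg | hnonneg
  · obtain ⟨A, hA⟩ := OnePoint.exists_mem_SL2 ℤ c
    obtain ⟨s, hs, hnd, hss, he⟩ := key A hA
    have h := (orderEq_K_slash hp hp3 hm hs hnd hss (he ▸ hneg)).hasOrderAtInfty
    rw [he] at h
    exact ⟨_, hasInvariantOrder_of_exists hA h, fun _ => rfl, fun h => absurd h hneg.not_ge⟩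
  · obtain ⟨r, hr, h⟩ := exists_hasInvariantOrder (f := K p m 1) (c := c) (r := 0) fun A hA => by
      obtain ⟨s, hs, hnd, hss, he⟩ := key A hA
      exact orderGE_K_slash hp hp3 hm hs hnd hss (he ▸ hnonneg)
    exact ⟨r, h, fun h => absurd hnonneg h.not_ge, fun _ => by simpa using hr⟩

lemma exceptionalOrder_neg_iff {p n : ℕ} (hp : 0 < p) :
    exceptionalOrder p n < 0 ↔
      0 < ((p : ℚ) - 1) * ((p : ℚ) + 1) / 12 + (n : ℚ) * ((n : ℚ) - (p : ℚ)) := by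
  have : (0 : ℚ) < 1 / (2 * (p : ℚ)) := by positivity
  rw [exceptionalOrder, neg_mul, neg_lt_zero, mul_pos_iff_of_pos_left this]

/-- Since p - 2n > 0, the square-root condition says (p - 2n)² > (2p² + 1)/3, which is four times
the inequality (p² - 1)/12 + n(n - p) > 0. -/
lemma exceptionalOrder_neg_iff_lt_sqrt {p n : ℕ} (hp : 0 < p) (hn : 2 * n < p) :
    exceptionalOrder p n < 0 ↔
      (n : ℝ) < (p : ℝ) / 2 - 1 / 2 * Real.sqrt ((2 * (p : ℝ) ^ 2 + 1) / 3) := by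
  have hn' : (2 * n : ℝ) < p := by exact_mod_cast hn
  have h1 : (n : ℝ) < (p : ℝ) / 2 - 1 / 2 * Real.sqrt ((2 * (p : ℝ) ^ 2 + 1) / 3) ↔
      Real.sqrt ((2 * (p : ℝ) ^ 2 + 1) / 3) < p - 2 * n := by
    constructor <;> intro h <;> linarith
  rw [h1, Real.sqrt_lt' (by linarith), exceptionalOrder_neg_iff hp]
  have h2 : 0 < ((p : ℚ) - 1) * ((p : ℚ) + 1) / 12 + (n : ℚ) * ((n : ℚ) - (p : ℚ)) ↔
      0 < ((p : ℝ) - 1) * ((p : ℝ) + 1) / 12 + (n : ℝ) * ((n : ℝ) - (p : ℝ)) := by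
    exact_mod_cast Iff.rfl
  rw [h2]
  constructor <;> intro h <;> nlinarith

lemma exceptionalOrder_one {p : ℕ} (hp : 0 < p) : exceptionalOrder p 1 =
    -(1 / (24 * (p : ℚ))) * ((p : ℚ) - 1) * ((p : ℚ) - 11) := by
  have : (p : ℚ) ≠ 0 := by exact_mod_cast hp.ne'
  rw [exceptionalOrder]
  push_cast
  field_simp
  ring

end InvariantOrders

end CrankDissection

end

theorem theorem4p5 (p m : ℕ) (hp : p.Prime) (hp3 : 3 < p) (hm : m ≤ p - 1) :
    (∃ r : WithTop ℚ,
      CrankDissection.HasInvariantOrder 1 (CrankDissection.K p m 1) ((0 : ℚ) : OnePoint ℚ) r ∧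
        (p ≤ 11 → 0 ≤ r) ∧
        (11 < p → r = ((-(1 / (24 * (p : ℚ))) * ((p : ℚ) - 1) * ((p : ℚ) - 11) : ℚ) : WithTop ℚ))) ∧
    (∀ n : ℕ, 2 ≤ n → n ≤ (p - 1) / 2 → ∃ r : WithTop ℚ,
      CrankDissection.HasInvariantOrder 1 (CrankDissection.K p m 1)
        ((1 / (n : ℚ) : ℚ) : OnePoint ℚ) r ∧
        ((n : ℝ) < (p : ℝ) / 2 - 1 / 2 * Real.sqrt ((2 * (p : ℝ) ^ 2 + 1) / 3) →
          r = ((-(1 / (2 * (p : ℚ))) *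
            (((p : ℚ) - 1) * ((p : ℚ) + 1) / 12 + (n : ℚ) * ((n : ℚ) - (p : ℚ))) : ℚ) :
              WithTop ℚ)) ∧
        (¬ (n : ℝ) < (p : ℝ) / 2 - 1 / 2 * Real.sqrt ((2 * (p : ℝ) ^ 2 + 1) / 3) → 0 ≤ r)) ∧
    (∀ n : ℕ, 2 ≤ n → n ≤ (p - 1) / 2 → ∃ r : WithTop ℚ,
      CrankDissection.HasInvariantOrder 1 (CrankDissection.K p m 1)
        (((n : ℚ) / (p : ℚ) : ℚ) : OnePoint ℚ) r ∧
        ((((p : ℚ) ^ 2 - 1) / (24 * (p : ℚ)) : ℚ) : WithTop ℚ) ≤ r) := by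
  refine ⟨?_, fun n hn2 hnp => ?_, fun n hn2 hnp => ?_⟩
  · obtain ⟨r, hr, hneg, hnonneg⟩ := CrankDissection.exists_hasInvariantOrder_K hp hp3 hm one_pos
      hp.one_lt fun A hA => by
        simpa using CrankDissection.bottom_left_of_cusp_zero hA
    have hp1 : (1 : ℚ) < p := by exact_mod_cast hp.one_lt
    have hpos : (0 : ℚ) < 1 / (24 * (p : ℚ)) * ((p : ℚ) - 1) :=
      mul_pos (by positivity) (by linarith)
    rw [CrankDissection.exceptionalOrder_one hp.pos] at hneg hnonneg
    refine ⟨r, hr, fun h => hnonneg ?_, fun h => hneg ?_⟩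
    · have : (p : ℚ) ≤ 11 := by exact_mod_cast h
      nlinarith
    · have : (11 : ℚ) < p := by exact_mod_cast h
      nlinarith
  · have hlt : 2 * n < p := by have := hp.pos; lia
    obtain ⟨r, hr, hneg, hnonneg⟩ := CrankDissection.exists_hasInvariantOrder_K (n := n) hp hp3 hm
      (by lia) (by lia) fun A hA => CrankDissection.bottom_left_of_cusp_inv (by lia) hA
    have hiff := CrankDissection.exceptionalOrder_neg_iff_lt_sqrt hp.pos hlt
    exact ⟨r, hr, fun h => hneg (hiff.mpr h), fun h => hnonneg (not_lt.mp (hiff.not.mpr h))⟩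
  · have hnd : ¬ p ∣ n := fun h => by
      have := Nat.le_of_dvd (by lia) h
      lia
    obtain ⟨r, hle, hr⟩ := CrankDissection.exists_hasInvariantOrder fun A hA =>
      CrankDissection.orderGE_K_slash_of_dvd hp hp3 hm
        (CrankDissection.dvd_bottom_left_of_cusp hp hnd hA)
    exact ⟨r, hr, hle⟩
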